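/- **Setting.** Let $-\infty\le a<b\le\infty$, let $q\ge 0$ and $\rho>0$ be real functions on $(a,b)$, and let $\varphi:\mathbb R\to(a,b)$ be an increasing change of variable of class $C^3$ with $\varphi'>0$, $\varphi(-\infty)=a$, $\varphi(+\infty)=b$ (for example the restriction to $\mathbb R$ of the inverse of a conformal map $\varphi^{-1}$ with $\varphi^{-1}(a)=-\infty$, $\varphi^{-1}(b)=\infty$). Put $$\tilde q=-\sqrt{\varphi'}\,\frac{d}{dx}\Big(\frac1{\varphi'}\frac{d}{dx}\sqrt{\varphi'}\Big)+(\varphi')^2\,q\circ\varphi ,\qquad w=(\rho\circ\varphi)\,(\varphi')^2 .$$ An eigenpair $(\lambda,v)$ of the transformed Sturm–Liouville equation is a real number $\lambda$ with a real-valued, twice differentiable $v\not\equiv0$ such that $-v''+\tilde q\,v=\lambda w\,v$ on $\mathbb R$. For $d>0$ let $\mathscr D_d=\{z\in\mathbb C:|\Im z|<d\}$ and, for $0<\epsilon<1$, $\mathscr D_d(\epsilon)=\{|\Re z|<1/\epsilon,\ |\Im z|<d(1-\epsilon)\}$. $\mathbf B_2(\mathscr D_d)$ is the set of functions $g$ analytic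 in $\mathscr D_d$ such that $\int_{-d}^{d}|g(x+iy)|\,dy\to0$ as $x\to\pm\infty$ and $\lim_{\epsilon\to0}\big(\int_{\partial\mathscr D_d(\epsilon)}|g(z)|^2|dz|\big)^{1/2}$ exists and is finite; a function on $\mathbb R$ belongs to $\mathbf B_2(\mathscr D_d)$ if it is the restriction of such a $g$. For $h>0$, $j\in\mathbb Z$ let $S(j,h)(x)=\frac{\sin(\pi(x-jh)/h)}{\pi(x-jh)/h}$ (equal to $1$ at $x=jh$) and $\delta^{(l)}_{j,k}=h^l\,\frac{d^l}{dx^l}S(j,h)(x)\big|_{x=kh}$. For $-M\le j,k\le N$ put $$A_{j,k}=-\tfrac1{h^2}\delta^{(2)}_{j,k}+\tilde q(kh)\,\delta^{(0)}_{j,k},\qquad (D^2)_{j,k}=w(kh)\,\delta^{(0)}_{j,k}.$$ **Theorem.** For every $v:\mathbb R\to\mathbb R$ and $d>0$ there is a constant $K=K_{v,d}>0$, depending only on $v$ and $d$, with the following property. Let $q,\rho,\varphi$ be as above, and let $(\lambda,v)$ be an eigenpair of the transformed equation. Assume that there are positive constants $A,\beta_L,\beta_R,\gamma_L,\gamma_R$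 with $$|v(x)|\le A\exp(-\beta_L e^{\gamma_L|x|})\ (x\le0),\qquad |v(x)|\le A\exp(-\beta_R e^{\gamma_R|x|})\ (x\ge0),$$ that $v\in\mathbf B_2(\mathscr D_d)$ with $d\le\frac{\pi}{2\gamma}$, $\gamma=\max\{\gamma_L,\gamma_R\}$, and that $\tilde q\ge\delta^{-1}$ on $\mathbb R$ for some $\delta>0$. Let $W$ be the principal branch of the Lambert function and $x^+=\max\{x,0\}$. For $n\in\mathbb N$ choose $M,N,\beta$ as follows: if $\gamma_L>\gamma_R$, or $\gamma_L=\gamma_R$ and $\beta_L\ge\beta_R$, then $$M=n,\quad N=\Big\lceil\tfrac{\gamma_L}{\gamma_R}\,n\Big(1+\tfrac{\log(\beta_L/\beta_R)}{W(\pi d\gamma_L n/\beta_L)}\Big)\Big\rceil^+,\quad \beta=\beta_L;$$ otherwise $$N=n,\quad M=\Big\lfloor\tfrac{\gamma_R}{\gamma_L}\,n\Big(1+\tfrac{\log(\beta_R/\beta_L)}{W(\pi d\gamma_R n/\beta_R)}\Big)\Big\rfloor^+,\quad \beta=\beta_R.$$ Take the mesh size $h=\dfrac{\log(\pi d\gamma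 n/\beta)}{\gamma n}$. Then for all sufficiently large $n$ the matrices $A$ and $D^2$ are symmetric positive definite, and there is a generalized eigenvalue $\mu$ of the pencil $(A,D^2)$ (that is, $Az=\mu D^2z$ for some $z\ne0$) with $$|\mu-\lambda|\le K\sqrt{\delta\lambda}\;\frac{n^{5/2}}{\log(n)^2}\,\exp\Big(-\frac{\pi d\gamma n}{\log(\pi d\gamma n/\beta)}\Big).$$ -/

import Mathlib

noncomputable section

namespace DESCM

open Filter Topology Set
open scoped ENNReal

/-! ### Sinc functions -/

/-- The Sinc function `S(j,h)(x) = sinc((x - jh)/h)` with `sinc z = sin (π z) / (π z)`, `sinc 0 = 1`.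
(`Real.sinc t = sin t / t` is the unnormalized function.) -/
def S (j : ℤ) (h : ℝ) (x : ℝ) : ℝ :=
  Real.sinc (Real.pi * ((x - j * h) / h))

/-- The entries `δ^{(l)}_{j,k} = h^l (d/dx)^l S(j,h)(x)` at `x = kh`. -/
def sincDelta (h : ℝ) (l : ℕ) (j k : ℤ) : ℝ :=
  h ^ l * iteratedDeriv l (S j h) (k * h)

/-! ### The class `B₂` on a strip -/

/-- The open strip `{z : |Im z| < d}`. -/
def strip (d : ℝ) : Set ℂ := {z : ℂ | |z.im| < d}

/-- The integral of `|g|²` with respect to arc length over the boundary of the rectangle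
`{z : |Re z| < 1/ε, |Im z| < d (1 - ε)}`: bottom, top, left and right side. -/
def rectBoundaryIntegral (d : ℝ) (g : ℂ → ℂ) (ε : ℝ) : ℝ≥0∞ :=
  (∫⁻ x in Ioo (-(1 / ε)) (1 / ε), ‖g (⟨x, -(d * (1 - ε))⟩ : ℂ)‖ₑ ^ 2) +
  (∫⁻ x in Ioo (-(1 / ε)) (1 / ε), ‖g (⟨x, d * (1 - ε)⟩ : ℂ)‖ₑ ^ 2) +
  (∫⁻ y in Ioo (-(d * (1 - ε))) (d * (1 - ε)), ‖g (⟨-(1 / ε), y⟩ : ℂ)‖ₑ ^ 2) +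
  (∫⁻ y in Ioo (-(d * (1 - ε))) (d * (1 - ε)), ‖g (⟨1 / ε, y⟩ : ℂ)‖ₑ ^ 2)

/-- `g` belongs to `B₂` of the strip of half-width `d`: it is analytic there, the integrals of `|g|`
over the vertical cross-sections tend to `0` at `±∞`, and the `L²` norms over the boundaries of
the exhausting rectangles have a finite limit. -/
structure MemB2 (d : ℝ) (g : ℂ → ℂ) : Prop where
  analytic : DifferentiableOn ℂ g (strip d)
  vertical_atTop :
    Tendsto (fun x : ℝ => ∫⁻ y in Ioo (-d) d, ‖g (⟨x, y⟩ : ℂ)‖ₑ) atTop (𝓝 0)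
  vertical_atBot :
    Tendsto (fun x : ℝ => ∫⁻ y in Ioo (-d) d, ‖g (⟨x, y⟩ : ℂ)‖ₑ) atBot (𝓝 0)
  norm_finite : ∃ L : ℝ≥0∞, L < ∞ ∧
    Tendsto (fun ε : ℝ => rectBoundaryIntegral d g ε ^ (1 / 2 : ℝ)) (𝓝[>] 0) (𝓝 L)

/-- A function on the real line belongs to `B₂` of the strip if it is the restriction of a
(necessarily unique) member of that class. -/
def RealMemB2 (d : ℝ) (v : ℝ → ℝ) : Prop :=
  ∃ g : ℂ → ℂ, MemB2 d g ∧ ∀ x : ℝ, g x = v x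

/-! ### The Liouville-transformed Sturm–Liouville equation -/

/-- `φ` is an admissible change of variable from the real line onto the interval `(a, b)`:
an increasing `C³` map with `φ' > 0`, sending `-∞` to `a` and `+∞` to `b`. -/
structure IsChangeOfVariable (a b : EReal) (φ : ℝ → ℝ) : Prop where
  contDiff : ContDiff ℝ 3 φ
  deriv_pos : ∀ x, 0 < deriv φ x
  tendsto_atBot : Tendsto (fun x : ℝ => (φ x : EReal)) atBot (𝓝 a)
  tendsto_atTop : Tendsto (fun x : ℝ => (φ x : EReal)) atTop (𝓝 b)

/-- The transformed potential
`q̃ = -√φ' · (d/dx) ( (1/φ') · (d/dx) √φ' ) + (φ')² · (q ∘ φ)`. -/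
def qTilde (φ q : ℝ → ℝ) (x : ℝ) : ℝ :=
  -√(deriv φ x) * deriv (fun y => 1 / deriv φ y * deriv (fun z => √(deriv φ z)) y) x
    + deriv φ x ^ 2 * q (φ x)

/-- The transformed weight `ρ(φ(x)) · φ'(x)²`. -/
def weight (φ ρ : ℝ → ℝ) (x : ℝ) : ℝ :=
  ρ (φ x) * deriv φ x ^ 2

/-- `(lam, v)` is an eigenpair of the transformed equation: `v` is a nontrivial solution of
`-v'' + q̃ v = lam · ρ(φ) (φ')² v` on the whole real line. -/
structure IsEigenpair (φ q ρ : ℝ → ℝ) (lam : ℝ) (v : ℝ → ℝ) : Prop where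
  nontrivial : ∃ x, v x ≠ 0
  differentiable : Differentiable ℝ v
  differentiable_deriv : Differentiable ℝ (deriv v)
  equation : ∀ x, -deriv (deriv v) x + qTilde φ q x * v x = lam * weight φ ρ x * v x

/-! ### The double exponential decay and the discretization parameters -/

/-- The principal branch of the Lambert `W` function: the inverse of `w ↦ w eʷ` on `[-1, ∞)`. -/
def lambertW (x : ℝ) : ℝ :=
  Function.invFunOn (fun w : ℝ => w * Real.exp w) (Ici (-1)) x

/-- Double exponential decay of `v` at both ends with separate left and right constants. -/
def DoubleExpDecay (v : ℝ → ℝ) (A βL βR γL γR : ℝ) : Prop :=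
  (∀ x ≤ 0, |v x| ≤ A * Real.exp (-βL * Real.exp (γL * |x|))) ∧
  (∀ x, 0 ≤ x → |v x| ≤ A * Real.exp (-βR * Real.exp (γR * |x|)))

/-- The case in which `n = M` and `β = βL`; in the complementary case `n = N` and `β = βR`. -/
def LeftCase (βL βR γL γR : ℝ) : Prop :=
  γR < γL ∨ (γL = γR ∧ βR ≤ βL)

open Classical in
/-- The constant `β` of the mesh size. -/
def meshBeta (βL βR γL γR : ℝ) : ℝ :=
  if LeftCase βL βR γL γR then βL else βR

open Classical in
/-- The number `M` of collocation points to the left of the origin.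
(`⌊·⌋₊` is the positive part of the floor.) -/
def leftPoints (d βL βR γL γR : ℝ) (n : ℕ) : ℕ :=
  if LeftCase βL βR γL γR then n
  else ⌊γR / γL * n *
    (1 + Real.log (βR / βL) / lambertW (Real.pi * d * γR * n / βR))⌋₊

open Classical in
/-- The number `N` of collocation points to the right of the origin.
(`⌈·⌉₊` is the positive part of the ceiling.) -/
def rightPoints (d βL βR γL γR : ℝ) (n : ℕ) : ℕ :=
  if LeftCase βL βR γL γR then
    ⌈γL / γR * n *
      (1 + Real.log (βL / βR) / lambertW (Real.pi * d * γL * n / βL))⌉₊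
  else n

/-- The mesh size `h = log(π d γ n / β) / (γ n)`. -/
def meshSize (d γ β : ℝ) (n : ℕ) : ℝ :=
  Real.log (Real.pi * d * γ * n / β) / (γ * n)

/-! ### The generalized matrix eigenvalue problem -/

/-- The index set `-M, …, N` of the collocation points. -/
abbrev Idx (M N : ℕ) : Type := ↥(Finset.Icc (-(M : ℤ)) (N : ℤ))

/-- The matrix `A`, with entries `-(1/h²) δ^{(2)}_{j,k} + q̃(kh) δ^{(0)}_{j,k}`. -/
def matA (φ q : ℝ → ℝ) (h : ℝ) (M N : ℕ) : Matrix (Idx M N) (Idx M N) ℝ :=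
  Matrix.of fun j k =>
    -(1 / h ^ 2) * sincDelta h 2 j k + qTilde φ q ((k : ℤ) * h) * sincDelta h 0 j k

/-- The diagonal matrix `D²`, with entries `φ'(kh)² ρ(φ(kh)) δ^{(0)}_{j,k}`. -/
def matD2 (φ ρ : ℝ → ℝ) (h : ℝ) (M N : ℕ) : Matrix (Idx M N) (Idx M N) ℝ :=
  Matrix.of fun j k => weight φ ρ ((k : ℤ) * h) * sincDelta h 0 j k

/-- `μ` is a generalized eigenvalue of the pencil `(A, B)`: `A z = μ B z` for some `z ≠ 0`. -/
def IsGenEigenvalue {ι : Type*} [Fintype ι] (A B : Matrix ι ι ℝ) (μ : ℝ) : Prop :=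
  ∃ z : ι → ℝ, z ≠ 0 ∧ A.mulVec z = μ • B.mulVec z

end DESCM

end

noncomputable section

namespace DESCM

open Filter Topology Set
open scoped ENNReal

/-! Sample the eigenfunction at the nodes: z_k = v(kh). By the differential equation, the residual
(Az - λD²z)_j is v''(jh) minus its truncated sinc approximation (`IsEigenpair.mulVec_sub`); the
potential and the weight cancel.

The residual has two sources. For nodes -m, …, m, the error is a residue sum: integrate g(z)/((z-a)²
sin(πz/h)), a = jh, around a rectangle and let the rectangle exhaust the strip; what remains is
O(1/(h sinh(πd/h))) (`rectIntegral_sincKernel`, `MemB2.exists_sinc_error`). Cutting the window down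
to -M, …, N drops samples whose total is at most 4A exp(-πdγn/2), because M, N and h make β exp(γx)
at least πdγn/2 at the first omitted node on each side (`eventually_points`,
`DoubleExpDecay.sum_outside_le`). Together the residual is O(nE) with E = exp(-πdγn/log(πdγn/β)).

A small residual forces a nearby eigenvalue (`exists_genEigenvalue_near`). Expand Dz in an
orthonormal eigenbasis of D⁻¹AD⁻¹. If ‖Dz‖² ≥ c, one of the M+N+1 coefficients is not small, and
Cauchy–Schwarz against the residual bounds |μ-λ|; the factor √(δμ) comes from the coercivity q̃ ≥
1/δ, and μ ≤ 4λ once the error is small. The bound c needs no regularity of the weight: λwv² ≥ -v''v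
+ v²/δ, and the right side is continuous and positive somewhere (`exists_pos_energy_density`).

This yields |μ-λ| ≤ C√(δλ) n²E with C depending on all the data. The claimed rate is larger by
√n/log²n, which tends to infinity, so C is absorbed for large n and K = 1 works. -/

/-! ### Cosine moments and the sinc differentiation matrices. -/

lemma sinc_eq_integral (u : ℝ) : Real.sinc u = ∫ t in (0:ℝ)..1, Real.cos (u * t) := by
  rcases eq_or_ne u 0 with rfl | hu
  · simp
  · rw [Real.sinc_of_ne_zero hu, intervalIntegral.integral_comp_mul_left _ hu, integral_cos]
    simp [div_eq_inv_mul]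

lemma hasDerivAt_integral_cos (f : ℝ → ℝ) (hf : Continuous f) (x : ℝ) :
    HasDerivAt (fun u => ∫ t in (0:ℝ)..1, f t * Real.cos (u * t))
      (∫ t in (0:ℝ)..1, -(t * f t) * Real.sin (x * t)) x := by
  refine (intervalIntegral.hasDerivAt_integral_of_dominated_loc_of_deriv_le
    (F := fun u t => f t * Real.cos (u * t)) (F' := fun u t => -(t * f t) * Real.sin (u * t))
    (bound := fun t => |t * f t|) (s := univ) univ_mem ?_ ?_ ?_ ?_ ?_ ?_).2
  · exact Eventually.of_forall fun u => (by fun_prop : Continuous _).aestronglyMeasurable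
  · exact (by fun_prop : Continuous _).intervalIntegrable _ _
  · exact (by fun_prop : Continuous _).aestronglyMeasurable
  · refine Eventually.of_forall fun t _ u _ => ?_
    rw [norm_mul, norm_neg, Real.norm_eq_abs, Real.norm_eq_abs]
    exact mul_le_of_le_one_right (abs_nonneg _) (Real.abs_sin_le_one _)
  · exact (by fun_prop : Continuous _).intervalIntegrable _ _
  · refine Eventually.of_forall fun t _ u _ => ?_
    have h := ((hasDerivAt_mul_const (x := u) t).cos).const_mul (f t)
    exact h.congr_deriv (by ring)

lemma hasDerivAt_integral_sin (f : ℝ → ℝ) (hf : Continuous f) (x : ℝ) :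
    HasDerivAt (fun u => ∫ t in (0:ℝ)..1, f t * Real.sin (u * t))
      (∫ t in (0:ℝ)..1, t * f t * Real.cos (x * t)) x := by
  refine (intervalIntegral.hasDerivAt_integral_of_dominated_loc_of_deriv_le
    (F := fun u t => f t * Real.sin (u * t)) (F' := fun u t => t * f t * Real.cos (u * t))
    (bound := fun t => |t * f t|) (s := univ) univ_mem ?_ ?_ ?_ ?_ ?_ ?_).2
  · exact Eventually.of_forall fun u => (by fun_prop : Continuous _).aestronglyMeasurable
  · exact (by fun_prop : Continuous _).intervalIntegrable _ _
  · exact (by fun_prop : Continuous _).aestronglyMeasurable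
  · refine Eventually.of_forall fun t _ u _ => ?_
    rw [norm_mul, Real.norm_eq_abs, Real.norm_eq_abs]
    exact mul_le_of_le_one_right (abs_nonneg _) (Real.abs_cos_le_one _)
  · exact (by fun_prop : Continuous _).intervalIntegrable _ _
  · refine Eventually.of_forall fun t _ u _ => ?_
    have h := ((hasDerivAt_mul_const (x := u) t).sin).const_mul (f t)
    exact h.congr_deriv (by ring)

/-- In integral form the removable singularity at 0 needs no separate treatment. -/
lemma deriv_sinc (x : ℝ) :
    HasDerivAt Real.sinc (∫ t in (0:ℝ)..1, -t * Real.sin (x * t)) x := by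
  have h := hasDerivAt_integral_cos (fun _ => 1) continuous_const x
  simp only [one_mul, mul_one] at h
  rwa [show (fun u => ∫ t in (0:ℝ)..1, Real.cos (u * t)) = Real.sinc from
    funext fun u => (sinc_eq_integral u).symm] at h

lemma deriv_deriv_sinc (x : ℝ) :
    HasDerivAt (deriv Real.sinc) (-∫ t in (0:ℝ)..1, t ^ 2 * Real.cos (x * t)) x := by
  rw [show deriv Real.sinc = _ from funext fun x => (deriv_sinc x).deriv]
  convert hasDerivAt_integral_sin (fun t => -t) (by fun_prop) x using 1
  rw [← intervalIntegral.integral_neg]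
  congr 1; ext t; ring

/-- The moments `∫₀¹ t² cos (π m t) dt`, which are the second sinc differences up to a factor. -/
def sincMoment (m : ℤ) : ℝ := ∫ t in (0:ℝ)..1, t ^ 2 * Real.cos (Real.pi * m * t)

lemma sincMoment_neg (m : ℤ) : sincMoment (-m) = sincMoment m := by
  unfold sincMoment
  congr 1; ext t
  rw [← Real.cos_neg]
  congr 2; push_cast; ring

lemma sincMoment_zero : sincMoment 0 = 1 / 3 := by
  simp [sincMoment]; norm_num

lemma sincMoment_of_ne_zero {m : ℤ} (hm : m ≠ 0) :
    sincMoment m = 2 * (-1) ^ m / (Real.pi * m) ^ 2 := by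
  have hc : Real.pi * (m : ℝ) ≠ 0 := mul_ne_zero Real.pi_ne_zero (by exact_mod_cast hm)
  set c := Real.pi * (m : ℝ) with hcdef
  -- Antiderivative from two integrations by parts; at the endpoints only the cosine term survives,
  -- since c is an integer multiple of π.
  have hd : ∀ t : ℝ, HasDerivAt (fun t : ℝ => t ^ 2 * Real.sin (c * t) / c
      + 2 * t * Real.cos (c * t) / c ^ 2 - 2 * Real.sin (c * t) / c ^ 3)
      (t ^ 2 * Real.cos (c * t)) t := by
    intro t
    have h1 : HasDerivAt (fun t : ℝ => c * t) c t := by simpa using (hasDerivAt_id t).const_mul c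
    have h2 := (((hasDerivAt_pow 2 t).mul h1.sin).div_const c).add
      (((((hasDerivAt_id t).const_mul 2).mul h1.cos).div_const (c ^ 2))) |>.sub
      ((h1.sin.const_mul 2).div_const (c ^ 3))
    refine h2.congr_deriv ?_
    simp only [id]
    field_simp
    ring
  have hs : Real.sin c = 0 := by
    rw [hcdef, mul_comm]; exact Real.sin_int_mul_pi m
  have hcos : Real.cos c = (-1) ^ m := by
    rw [hcdef, mul_comm]; exact Real.cos_int_mul_pi m
  unfold sincMoment
  rw [← hcdef, intervalIntegral.integral_eq_sub_of_hasDerivAt (fun t _ => hd t)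
    ((by fun_prop : Continuous _).intervalIntegrable _ _)]
  simp [hs, hcos]

lemma abs_sincMoment_le (m : ℤ) : |sincMoment m| ≤ 1 := by
  have h := intervalIntegral.norm_integral_le_of_norm_le_const (a := (0:ℝ)) (b := 1) (C := 1)
    (f := fun t => t ^ 2 * Real.cos (Real.pi * m * t)) ?_
  · simpa [sincMoment] using h
  · intro t ht
    rw [uIoc_of_le zero_le_one] at ht
    rw [norm_mul, Real.norm_eq_abs, Real.norm_eq_abs, abs_of_nonneg (sq_nonneg t)]
    exact mul_le_one₀ (by nlinarith [ht.1, ht.2]) (abs_nonneg _) (Real.abs_cos_le_one _)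

lemma sincDelta_zero {h : ℝ} (hh : h ≠ 0) (j k : ℤ) :
    sincDelta h 0 j k = if j = k then 1 else 0 := by
  have : Real.pi * (((k:ℝ) * h - j * h) / h) = ((k - j : ℤ) : ℝ) * Real.pi := by
    push_cast; field_simp
  simp only [sincDelta, pow_zero, iteratedDeriv_zero, one_mul, S, this]
  split_ifs with hjk
  · simp [hjk]
  · rw [Real.sinc_of_ne_zero, Real.sin_int_mul_pi, zero_div]
    refine mul_ne_zero ?_ Real.pi_ne_zero
    exact_mod_cast sub_ne_zero.mpr (Ne.symm hjk)

lemma sincDelta_two {h : ℝ} (hh : h ≠ 0) (j k : ℤ) :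
    sincDelta h 2 j k = -(Real.pi ^ 2 * sincMoment (k - j)) := by
  have ha : ∀ x : ℝ, HasDerivAt (fun x : ℝ => Real.pi * ((x - j * h) / h)) (Real.pi / h) x := by
    intro x
    have := (((hasDerivAt_id x).sub_const ((j:ℝ) * h)).div_const h).const_mul Real.pi
    simpa [div_eq_mul_inv] using this
  have h1 : deriv (S j h) = fun x => deriv Real.sinc (Real.pi * ((x - j * h) / h)) *
      (Real.pi / h) := by
    ext x
    have := (deriv_sinc (Real.pi * ((x - j * h) / h))).comp x (ha x)
    rw [(deriv_sinc _).deriv]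
    exact this.deriv
  have hk : Real.pi * (((k:ℝ) * h - j * h) / h) = Real.pi * ((k - j : ℤ) : ℝ) := by
    push_cast; field_simp
  have h2 := ((deriv_deriv_sinc (Real.pi * (((k:ℝ) * h - j * h) / h))).comp
    ((k:ℝ) * h) (ha _)).mul_const (Real.pi / h)
  have h3 : iteratedDeriv 2 (S j h) (k * h) =
      -sincMoment (k - j) * (Real.pi / h) * (Real.pi / h) := by
    rw [iteratedDeriv_succ, iteratedDeriv_one, h1]
    rw [hk] at h2
    exact h2.deriv
  rw [sincDelta, h3]
  field_simp

/-! ### Positive definiteness of the two matrices. -/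

/-- The moments are Fourier coefficients of the nonnegative symbol t², so the form is the integral
of t² |∑ x_i exp(iπ k_i t)|², here split into cosine and sine parts. -/
lemma sum_sincMoment_nonneg {ι : Type*} (s : Finset ι) (k : ι → ℤ) (x : ι → ℝ) :
    0 ≤ ∑ i ∈ s, ∑ j ∈ s, x i * x j * sincMoment (k j - k i) := by
  have h1 : ∑ i ∈ s, ∑ j ∈ s, x i * x j * sincMoment (k j - k i) =
      ∫ t in (0:ℝ)..1, t ^ 2 * ((∑ i ∈ s, x i * Real.cos (Real.pi * k i * t)) ^ 2 +
        (∑ i ∈ s, x i * Real.sin (Real.pi * k i * t)) ^ 2) := by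
    simp only [sincMoment, ← intervalIntegral.integral_const_mul]
    rw [Finset.sum_congr rfl fun i _ => (intervalIntegral.integral_finsetSum
      (μ := MeasureTheory.volume) (a := 0) (b := 1) (s := s)
      (f := fun j t => x i * x j * (t ^ 2 * Real.cos (Real.pi * (k j - k i : ℤ) * t)))
      fun j _ => (by fun_prop : Continuous _).intervalIntegrable _ _).symm]
    rw [← intervalIntegral.integral_finsetSum
      fun i _ => (by fun_prop : Continuous _).intervalIntegrable _ _]
    congr 1; ext t
    rw [sq (∑ i ∈ s, x i * Real.cos _), sq (∑ i ∈ s, x i * Real.sin _), Finset.sum_mul_sum,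
      Finset.sum_mul_sum, ← Finset.sum_add_distrib, Finset.mul_sum]
    refine Finset.sum_congr rfl fun i _ => ?_
    rw [← Finset.sum_add_distrib, Finset.mul_sum]
    refine Finset.sum_congr rfl fun j _ => ?_
    rw [show Real.pi * ((k j - k i : ℤ) : ℝ) * t = Real.pi * k j * t - Real.pi * k i * t by
      push_cast; ring, Real.cos_sub]
    ring
  rw [h1]
  exact intervalIntegral.integral_nonneg zero_le_one fun t _ => by positivity

lemma matA_apply {φ q : ℝ → ℝ} {h : ℝ} (hh : h ≠ 0) {M N : ℕ} (j k : Idx M N) :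
    matA φ q h M N j k = Real.pi ^ 2 / h ^ 2 * sincMoment (k - j) +
      if j = k then qTilde φ q ((k : ℤ) * h) else 0 := by
  simp only [matA, Matrix.of_apply, sincDelta_two hh, sincDelta_zero hh]
  simp only [Subtype.ext_iff]
  split_ifs <;> field_simp; ring

lemma matD2_eq {φ ρ : ℝ → ℝ} {h : ℝ} (hh : h ≠ 0) (M N : ℕ) :
    matD2 φ ρ h M N = Matrix.diagonal fun k : Idx M N => weight φ ρ ((k : ℤ) * h) := by
  ext j k
  simp only [matD2, Matrix.of_apply, sincDelta_zero hh, Matrix.diagonal_apply, Subtype.ext_iff]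
  split_ifs with hjk <;> simp [hjk]

/-- The Toeplitz part of the form is nonnegative and is discarded; the diagonal part alone gives the
coercivity. This yields definiteness and later bounds the Euclidean length of the eigenvectors. -/
lemma le_matA_quadratic {φ q : ℝ → ℝ} {h r : ℝ} (hh : h ≠ 0) {M N : ℕ}
    (hq : ∀ x, r ≤ qTilde φ q x) (x : Idx M N → ℝ) :
    r * (x ⬝ᵥ x) ≤ x ⬝ᵥ (matA φ q h M N).mulVec x := by
  have h1 : x ⬝ᵥ (matA φ q h M N).mulVec x =
      Real.pi ^ 2 / h ^ 2 * (∑ i, ∑ j, x i * x j * sincMoment ((j : ℤ) - (i : ℤ))) +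
        ∑ i : Idx M N, qTilde φ q ((i : ℤ) * h) * (x i * x i) := by
    simp only [dotProduct, Matrix.mulVec, matA_apply hh, add_mul, Finset.sum_add_distrib,
      mul_add, ite_mul, zero_mul, Finset.sum_ite_eq, Finset.mem_univ, if_true, Finset.mul_sum]
    congr 1
    · refine Finset.sum_congr rfl fun i _ => Finset.sum_congr rfl fun j _ => by ring
    · refine Finset.sum_congr rfl fun i _ => by ring
  have h2 := sum_sincMoment_nonneg (Finset.univ : Finset (Idx M N)) (fun i => (i : ℤ)) x
  have h3 : r * (x ⬝ᵥ x) ≤ ∑ i : Idx M N, qTilde φ q ((i : ℤ) * h) * (x i * x i) := by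
    rw [dotProduct, Finset.mul_sum]
    exact Finset.sum_le_sum fun i _ => mul_le_mul_of_nonneg_right (hq _) (mul_self_nonneg _)
  rw [h1]
  have : 0 ≤ Real.pi ^ 2 / h ^ 2 := by positivity
  nlinarith [mul_nonneg this h2]

lemma matA_isHermitian {φ q : ℝ → ℝ} {h : ℝ} (hh : h ≠ 0) (M N : ℕ) :
    (matA φ q h M N).IsHermitian := by
  refine Matrix.IsHermitian.ext fun i j => ?_
  rw [matA_apply hh, matA_apply hh, star_trivial, ← sincMoment_neg, neg_sub]
  congr 1
  rcases eq_or_ne i j with rfl | hij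
  · rfl
  · simp [hij, hij.symm]

lemma matA_posDef {φ q : ℝ → ℝ} {h r : ℝ} (hh : h ≠ 0) (hr : 0 < r) (M N : ℕ)
    (hq : ∀ x, r ≤ qTilde φ q x) : (matA φ q h M N).PosDef := by
  refine Matrix.PosDef.of_dotProduct_mulVec_pos (matA_isHermitian hh M N) fun x hx => ?_
  rw [star_trivial]
  refine lt_of_lt_of_le (mul_pos hr ?_) (le_matA_quadratic hh hq x)
  simpa using Matrix.dotProduct_star_self_pos_iff.mpr hx

lemma matD2_posDef {φ ρ : ℝ → ℝ} {h : ℝ} (hh : h ≠ 0) (M N : ℕ)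
    (hw : ∀ x, 0 < weight φ ρ x) : (matD2 φ ρ h M N).PosDef := by
  rw [matD2_eq hh]
  exact Matrix.PosDef.diagonal fun k => hw _

/-! ### From a small residual to a nearby generalized eigenvalue. -/

/-- Pairing the residual with a D²-normalized eigenvector u gives (μ-λ) times the coefficient of z
along u. Choosing the eigenvector with a large coefficient costs the factor `Fintype.card ι`, and
coercivity gives |u|² ≤ δμ. -/
lemma exists_genEigenvalue_near {ι : Type*} [Fintype ι] [DecidableEq ι] {A : Matrix ι ι ℝ}
    (hA : A.IsHermitian) {w : ι → ℝ} (hw : ∀ i, 0 < w i) {δ : ℝ} (hδ : 0 < δ)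
    (hAδ : ∀ x : ι → ℝ, δ⁻¹ * (x ⬝ᵥ x) ≤ x ⬝ᵥ A.mulVec x) (z : ι → ℝ) (lam : ℝ) {c : ℝ}
    (hc : 0 < c) (hcz : c ≤ ∑ i, w i * z i ^ 2) :
    ∃ μ : ℝ, 0 ≤ μ ∧ IsGenEigenvalue A (Matrix.diagonal w) μ ∧
      c * (μ - lam) ^ 2 ≤ Fintype.card ι *
        (δ * μ * ∑ i, (A.mulVec z i - lam * (w i * z i)) ^ 2) := by
  have hs : ∀ i, 0 < √(w i) := fun i => Real.sqrt_pos.mpr (hw i)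
  have hsq : ∀ i, √(w i) * √(w i) = w i := fun i => Real.mul_self_sqrt (hw i).le
  -- The symmetric matrix D⁻¹AD⁻¹; its eigenvectors b give solutions u = D⁻¹b of the pencil problem.
  set B : Matrix ι ι ℝ := Matrix.of fun i j => A i j / (√(w i) * √(w j)) with hBdef
  have hB : B.IsHermitian := by
    refine Matrix.IsHermitian.ext fun i j => ?_
    have := hA.apply i j
    simp only [star_trivial] at this
    simp [hBdef, this, mul_comm]
  set b := hB.eigenvectorBasis with hb
  set u : ι → ι → ℝ := fun i k => b i k / √(w k) with hu
  have hAu : ∀ i k, A.mulVec (u i) k = hB.eigenvalues i * (w k * u i k) := by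
    intro i k
    have h1 := congrFun (hB.mulVec_eigenvectorBasis i) k
    have h2 : A.mulVec (u i) k = √(w k) * B.mulVec (b i) k := by
      simp only [Matrix.mulVec, dotProduct, Finset.mul_sum, hBdef, Matrix.of_apply, hu]
      refine Finset.sum_congr rfl fun l _ => ?_
      have := (hs k).ne'; have := (hs l).ne'
      field_simp
    have h3 : w k * u i k = √(w k) * b i k := by
      rw [← Real.div_sqrt (x := w k), div_mul_comm, mul_comm]
    rw [h2, h1, h3]
    simp only [Pi.smul_apply, smul_eq_mul, hb]
    ring
  have huu : ∀ i, ∑ k, w k * (u i k * u i k) = 1 := by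
    intro i
    have h1 : ‖b i‖ ^ 2 = 1 := by rw [b.orthonormal.1 i, one_pow]
    rw [EuclideanSpace.norm_sq_eq] at h1
    rw [← h1]
    refine Finset.sum_congr rfl fun k _ => ?_
    rw [Real.norm_eq_abs, sq_abs, ← hsq k]
    have := (hs k).ne'
    simp only [hu]; field_simp
  set a : ι → ℝ := fun i => ∑ k, w k * (u i k * z k) with ha
  -- Parseval for the vector Dz, since a_i is the inner product of b_i with Dz.
  have hsum : ∑ i, a i ^ 2 = ∑ k, w k * z k ^ 2 := by
    set y : EuclideanSpace ℝ ι := WithLp.toLp 2 fun k => √(w k) * z k with hy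
    have h1 := b.sum_sq_norm_inner_right y
    rw [EuclideanSpace.norm_sq_eq] at h1
    have h2 : ∀ i, ‖inner ℝ (b i) y‖ ^ 2 = a i ^ 2 := by
      intro i
      rw [Real.norm_eq_abs, sq_abs]
      congr 1
      rw [PiLp.inner_apply]
      refine Finset.sum_congr rfl fun k _ => ?_
      have h3 : w k * (u i k * z k) = √(w k) * b i k * z k := by
        rw [← mul_assoc, ← Real.div_sqrt (x := w k), div_mul_comm, mul_comm (_ / _)]
      rw [h3, hy, RCLike.inner_apply, conj_trivial]
      ring
    rw [Finset.sum_congr rfl fun i _ => (h2 i).symm, h1]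
    refine Finset.sum_congr rfl fun k _ => ?_
    rw [Real.norm_eq_abs, sq_abs, hy]
    simp only [mul_pow, Real.sq_sqrt (hw k).le]
  set Δ : ι → ℝ := fun i => A.mulVec z i - lam * (w i * z i) with hΔ
  have hne : (Finset.univ : Finset ι).Nonempty := by
    by_contra h
    rw [Finset.not_nonempty_iff_eq_empty] at h
    rw [h, Finset.sum_empty] at hcz
    linarith
  -- Pigeonhole: the squares of the coefficients sum to at least c, so some a_i² is at least their
  -- average.
  obtain ⟨i, -, hi⟩ : ∃ i ∈ (Finset.univ : Finset ι), c ≤ Fintype.card ι * a i ^ 2 := by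
    refine Finset.exists_le_of_sum_le hne ?_
    rw [← Finset.mul_sum, hsum, Finset.sum_const, Finset.card_univ, nsmul_eq_mul]
    gcongr
  have huAu : u i ⬝ᵥ A.mulVec (u i) = hB.eigenvalues i := by
    rw [dotProduct, ← mul_one (hB.eigenvalues i), ← huu i, Finset.mul_sum]
    refine Finset.sum_congr rfl fun k _ => ?_
    rw [hAu]; ring
  have hnn : 0 ≤ u i ⬝ᵥ u i := Finset.sum_nonneg fun k _ => mul_self_nonneg _
  have hle : u i ⬝ᵥ u i ≤ δ * hB.eigenvalues i := by
    have := hAδ (u i)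
    rwa [huAu, inv_mul_le_iff₀ hδ] at this
  have hμ : 0 ≤ hB.eigenvalues i := by
    by_contra h
    push Not at h
    nlinarith
  -- Symmetry of A moves it onto the eigenvector.
  have hinner : ∑ k, u i k * Δ k = (hB.eigenvalues i - lam) * a i := by
    have h1 : u i ⬝ᵥ A.mulVec z = A.mulVec (u i) ⬝ᵥ z := by
      rw [Matrix.dotProduct_mulVec, ← Matrix.mulVec_transpose]
      have : A.transpose = A := by
        rwa [Matrix.IsHermitian, Matrix.conjTranspose_eq_transpose_of_trivial] at hA
      rw [this]
    have h2 : ∑ k, u i k * A.mulVec z k = hB.eigenvalues i * a i := by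
      rw [dotProduct, dotProduct] at h1
      rw [h1, ha, Finset.mul_sum]
      refine Finset.sum_congr rfl fun k _ => ?_
      rw [hAu]; ring
    simp only [hΔ, mul_sub, Finset.sum_sub_distrib]
    rw [h2, sub_mul, ha, Finset.mul_sum, Finset.mul_sum]
    congr 1
    refine Finset.sum_congr rfl fun k _ => by ring
  have hcs := Finset.sum_mul_sq_le_sq_mul_sq Finset.univ (u i) Δ
  refine ⟨hB.eigenvalues i, hμ, ⟨u i, ?_, ?_⟩, ?_⟩
  · intro h0
    have := huu i
    simp [h0] at this
  · ext k
    rw [hAu, Pi.smul_apply, Matrix.mulVec_diagonal, smul_eq_mul]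
  · have hΔ0 : 0 ≤ ∑ k, Δ k ^ 2 := Finset.sum_nonneg fun k _ => sq_nonneg _
    have h3 : ∑ k, u i k ^ 2 ≤ δ * hB.eigenvalues i := by
      simpa [dotProduct, sq] using hle
    calc c * (hB.eigenvalues i - lam) ^ 2
        ≤ Fintype.card ι * a i ^ 2 * (hB.eigenvalues i - lam) ^ 2 := by gcongr
      _ = Fintype.card ι * (∑ k, u i k * Δ k) ^ 2 := by rw [hinner]; ring
      _ ≤ Fintype.card ι * (δ * hB.eigenvalues i * ∑ k, Δ k ^ 2) := by
        gcongr
        exact hcs.trans (mul_le_mul_of_nonneg_right h3 hΔ0)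

/-! ### Contour integrals over rectangles and residues at real poles. -/

section Residue
open Complex Asymptotics

/-- The counterclockwise integral over the boundary of the rectangle `|Re z| < R`, `|Im z| < y`. -/
def rectIntegral (R y : ℝ) (F : ℂ → ℂ) : ℂ :=
  (∫ x : ℝ in -R..R, F (x + (-y : ℝ) * I)) - (∫ x : ℝ in -R..R, F (x + y * I)) +
    I • (∫ t : ℝ in -y..y, F (R + t * I)) - I • (∫ t : ℝ in -y..y, F ((-R : ℝ) + t * I))

/-- The boundary of the rectangle `|Re z| < R`, `|Im z| < y`. -/
def rectBoundary (R y : ℝ) : Set ℂ :=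
  {z | |z.re| ≤ R ∧ |z.im| ≤ y ∧ (|z.re| = R ∨ |z.im| = y)}

lemma bottom_mem_rectBoundary {R y x : ℝ} (hy : 0 ≤ y) (hx : |x| ≤ R) :
    (x + (-y : ℝ) * I : ℂ) ∈ rectBoundary R y := by
  simp [rectBoundary, hx, abs_of_nonneg hy]

lemma top_mem_rectBoundary {R y x : ℝ} (hy : 0 ≤ y) (hx : |x| ≤ R) :
    (x + y * I : ℂ) ∈ rectBoundary R y := by
  simp [rectBoundary, hx, abs_of_nonneg hy]

lemma right_mem_rectBoundary {R y t : ℝ} (hR : 0 ≤ R) (ht : |t| ≤ y) :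
    (R + t * I : ℂ) ∈ rectBoundary R y := by
  simp [rectBoundary, ht, abs_of_nonneg hR]

lemma left_mem_rectBoundary {R y t : ℝ} (hR : 0 ≤ R) (ht : |t| ≤ y) :
    ((-R : ℝ) + t * I : ℂ) ∈ rectBoundary R y := by
  simp [rectBoundary, ht, abs_of_nonneg hR]

lemma abs_le_of_mem_uIcc_neg {R x : ℝ} (hR : 0 ≤ R) (hx : x ∈ uIcc (-R) R) : |x| ≤ R := by
  rw [uIcc_of_le (by linarith)] at hx
  exact abs_le.mpr hx

lemma rectBoundary_sides_intervalIntegrable {R y : ℝ} (hR : 0 ≤ R) (hy : 0 ≤ y) {F : ℂ → ℂ}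
    (hF : ContinuousOn F (rectBoundary R y)) :
    IntervalIntegrable (fun x : ℝ => F (x + (-y : ℝ) * I)) MeasureTheory.volume (-R) R ∧
    IntervalIntegrable (fun x : ℝ => F (x + y * I)) MeasureTheory.volume (-R) R ∧
    IntervalIntegrable (fun t : ℝ => F (R + t * I)) MeasureTheory.volume (-y) y ∧
    IntervalIntegrable (fun t : ℝ => F ((-R : ℝ) + t * I)) MeasureTheory.volume (-y) y := by
  refine ⟨?_, ?_, ?_, ?_⟩ <;> refine ContinuousOn.intervalIntegrable ?_ <;>
    refine hF.comp (by fun_prop) fun x hx => ?_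
  · exact bottom_mem_rectBoundary hy (abs_le_of_mem_uIcc_neg hR hx)
  · exact top_mem_rectBoundary hy (abs_le_of_mem_uIcc_neg hR hx)
  · exact right_mem_rectBoundary hR (abs_le_of_mem_uIcc_neg hy hx)
  · exact left_mem_rectBoundary hR (abs_le_of_mem_uIcc_neg hy hx)

lemma rectIntegral_congr {R y : ℝ} (hR : 0 ≤ R) (hy : 0 ≤ y) {F G : ℂ → ℂ}
    (h : EqOn F G (rectBoundary R y)) : rectIntegral R y F = rectIntegral R y G := by
  unfold rectIntegral
  congr 1
  · congr 1
    · congr 1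
      · exact intervalIntegral.integral_congr fun x hx =>
          h (bottom_mem_rectBoundary hy (abs_le_of_mem_uIcc_neg hR hx))
      · exact intervalIntegral.integral_congr fun x hx =>
          h (top_mem_rectBoundary hy (abs_le_of_mem_uIcc_neg hR hx))
    · congr 1
      exact intervalIntegral.integral_congr fun x hx =>
        h (right_mem_rectBoundary hR (abs_le_of_mem_uIcc_neg hy hx))
  · congr 1
    exact intervalIntegral.integral_congr fun x hx =>
      h (left_mem_rectBoundary hR (abs_le_of_mem_uIcc_neg hy hx))

lemma rectIntegral_add {R y : ℝ} (hR : 0 ≤ R) (hy : 0 ≤ y) {F G : ℂ → ℂ}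
    (hF : ContinuousOn F (rectBoundary R y)) (hG : ContinuousOn G (rectBoundary R y)) :
    rectIntegral R y (fun z => F z + G z) = rectIntegral R y F + rectIntegral R y G := by
  obtain ⟨f1, f2, f3, f4⟩ := rectBoundary_sides_intervalIntegrable hR hy hF
  obtain ⟨g1, g2, g3, g4⟩ := rectBoundary_sides_intervalIntegrable hR hy hG
  unfold rectIntegral
  rw [intervalIntegral.integral_add f1 g1, intervalIntegral.integral_add f2 g2,
    intervalIntegral.integral_add f3 g3, intervalIntegral.integral_add f4 g4]
  simp only [smul_eq_mul]; ring

lemma rectIntegral_const_mul (R y : ℝ) (c : ℂ) (F : ℂ → ℂ) :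
    rectIntegral R y (fun z => c * F z) = c * rectIntegral R y F := by
  unfold rectIntegral
  simp only [intervalIntegral.integral_const_mul, smul_eq_mul]; ring

lemma rectIntegral_sum {R y : ℝ} (hR : 0 ≤ R) (hy : 0 ≤ y) {ι : Type*} (s : Finset ι)
    {F : ι → ℂ → ℂ} (hF : ∀ i ∈ s, ContinuousOn (F i) (rectBoundary R y)) :
    rectIntegral R y (fun z => ∑ i ∈ s, F i z) = ∑ i ∈ s, rectIntegral R y (F i) := by
  classical
  induction s using Finset.induction_on with
  | empty => simp [rectIntegral]
  | insert a s ha ih =>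
    simp only [Finset.sum_insert ha]
    rw [rectIntegral_add hR hy (hF a (Finset.mem_insert_self a s))
      (continuousOn_finsetSum _ fun i hi => hF i (Finset.mem_insert_of_mem hi)),
      ih fun i hi => hF i (Finset.mem_insert_of_mem hi)]

lemma integral_horizontal {f F : ℂ → ℂ} {a b c : ℝ}
    (hf : ∀ x ∈ uIcc a b, HasDerivAt f (F (x + c * I)) (x + c * I))
    (hF : ContinuousOn (fun x : ℝ => F (x + c * I)) (uIcc a b)) :
    ∫ x : ℝ in a..b, F (x + c * I) = f (b + c * I) - f (a + c * I) := by
  refine intervalIntegral.integral_eq_sub_of_hasDerivAt (f := fun x : ℝ => f (x + c * I))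
    (fun x hx => ?_) hF.intervalIntegrable
  have h1 : HasDerivAt (fun x : ℝ => (x : ℂ) + c * I) 1 x :=
    (hasDerivAt_id (x : ℂ)).comp_ofReal.add_const _
  have h2 := (hf x hx).comp x h1
  rwa [mul_one] at h2

lemma integral_vertical {f F : ℂ → ℂ} {a b c : ℝ}
    (hf : ∀ x ∈ uIcc a b, HasDerivAt f (F (c + x * I)) (c + x * I))
    (hF : ContinuousOn (fun x : ℝ => F (c + x * I)) (uIcc a b)) :
    I • ∫ x : ℝ in a..b, F (c + x * I) = f (c + b * I) - f (c + a * I) := by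
  rw [← intervalIntegral.integral_smul]
  refine intervalIntegral.integral_eq_sub_of_hasDerivAt (f := fun x : ℝ => f (c + x * I))
    (fun x hx => ?_) (hF.const_smul I).intervalIntegrable
  have h1 : HasDerivAt (fun x : ℝ => (c : ℂ) + x * I) I x := by
    have := ((hasDerivAt_id (x : ℂ)).comp_ofReal.mul_const I).const_add (c : ℂ)
    simpa using this
  have h2 := (hf x hx).comp x h1
  rwa [mul_comm] at h2

lemma sub_ne_zero_of_mem_rectBoundary {R y p : ℝ} (hy : 0 < y) (hp : |p| < R) {z : ℂ}
    (hz : z ∈ rectBoundary R y) : z - p ≠ 0 := by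
  intro h0
  rw [sub_eq_zero] at h0
  obtain ⟨-, -, h | h⟩ := hz
  · rw [h0, ofReal_re] at h; linarith
  · rw [h0, ofReal_im, abs_zero] at h; linarith

/-- Each side contributes the difference of the primitive at its ends, and around the closed contour
these cancel. -/
lemma rectIntegral_of_hasDerivAt {R y : ℝ} (hR : 0 ≤ R) (hy : 0 ≤ y) {f F : ℂ → ℂ}
    (hf : ∀ z ∈ rectBoundary R y, HasDerivAt f (F z) z)
    (hF : ContinuousOn F (rectBoundary R y)) : rectIntegral R y F = 0 := by
  have c1 : ContinuousOn (fun x : ℝ => F (x + (-y : ℝ) * I)) (uIcc (-R) R) :=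
    hF.comp (by fun_prop) fun x hx => bottom_mem_rectBoundary hy (abs_le_of_mem_uIcc_neg hR hx)
  have c2 : ContinuousOn (fun x : ℝ => F (x + y * I)) (uIcc (-R) R) :=
    hF.comp (by fun_prop) fun x hx => top_mem_rectBoundary hy (abs_le_of_mem_uIcc_neg hR hx)
  have c3 : ContinuousOn (fun t : ℝ => F (R + t * I)) (uIcc (-y) y) :=
    hF.comp (by fun_prop) fun x hx => right_mem_rectBoundary hR (abs_le_of_mem_uIcc_neg hy hx)
  have c4 : ContinuousOn (fun t : ℝ => F ((-R : ℝ) + t * I)) (uIcc (-y) y) :=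
    hF.comp (by fun_prop) fun x hx => left_mem_rectBoundary hR (abs_le_of_mem_uIcc_neg hy hx)
  unfold rectIntegral
  rw [integral_horizontal (fun x hx => hf _ (bottom_mem_rectBoundary hy
      (abs_le_of_mem_uIcc_neg hR hx))) c1,
    integral_horizontal (fun x hx => hf _ (top_mem_rectBoundary hy
      (abs_le_of_mem_uIcc_neg hR hx))) c2,
    integral_vertical (fun x hx => hf _ (right_mem_rectBoundary hR
      (abs_le_of_mem_uIcc_neg hy hx))) c3,
    integral_vertical (fun x hx => hf _ (left_mem_rectBoundary hR
      (abs_le_of_mem_uIcc_neg hy hx))) c4]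
  ring

lemma log_neg_of_im_pos {w : ℂ} (hw : 0 < w.im) : log (-w) = log w - Real.pi * I := by
  simp [log, arg_neg_eq_arg_sub_pi_of_im_pos hw]; ring

lemma log_neg_of_im_neg {w : ℂ} (hw : w.im < 0) : log (-w) = log w + Real.pi * I := by
  simp [log, arg_neg_eq_arg_add_pi_of_im_neg hw]; ring

lemma rectIntegral_inv_sub {R y p : ℝ} (hy : 0 < y) (hp : |p| < R) :
    rectIntegral R y (fun z => (z - p)⁻¹) = 2 * Real.pi * I := by
  have hR : 0 ≤ R := (abs_nonneg p).trans hp.le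
  obtain ⟨hp1, hp2⟩ := abs_lt.mp hp
  have hF : ContinuousOn (fun z : ℂ => (z - p)⁻¹) (rectBoundary R y) :=
    ContinuousOn.inv₀ (by fun_prop) fun z hz => sub_ne_zero_of_mem_rectBoundary hy hp hz
  have c1 : ContinuousOn (fun x : ℝ => ((x + (-y : ℝ) * I : ℂ) - p)⁻¹) (uIcc (-R) R) :=
    hF.comp (by fun_prop) fun x hx => bottom_mem_rectBoundary hy.le (abs_le_of_mem_uIcc_neg hR hx)
  have c2 : ContinuousOn (fun x : ℝ => ((x + y * I : ℂ) - p)⁻¹) (uIcc (-R) R) :=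
    hF.comp (by fun_prop) fun x hx => top_mem_rectBoundary hy.le (abs_le_of_mem_uIcc_neg hR hx)
  have c3 : ContinuousOn (fun t : ℝ => ((R + t * I : ℂ) - p)⁻¹) (uIcc (-y) y) :=
    hF.comp (by fun_prop) fun x hx => right_mem_rectBoundary hR (abs_le_of_mem_uIcc_neg hy.le hx)
  have c4 : ContinuousOn (fun t : ℝ => (((-R : ℝ) + t * I : ℂ) - p)⁻¹) (uIcc (-y) y) :=
    hF.comp (by fun_prop) fun x hx => left_mem_rectBoundary hR (abs_le_of_mem_uIcc_neg hy.le hx)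
  have hd : ∀ z : ℂ, z - p ∈ slitPlane → HasDerivAt (fun z => log (z - p)) (z - p)⁻¹ z := by
    intro z hz
    have := ((hasDerivAt_id z).sub_const (p : ℂ)).clog hz
    simpa using this
  -- The left side crosses the branch cut of log(z-p), so log(p-z) serves as primitive there; the
  -- mismatch at the two left corners is πi each and adds up to 2πi.
  have hd' : ∀ z : ℂ, p - z ∈ slitPlane → HasDerivAt (fun z => log (p - z)) (z - p)⁻¹ z := by
    intro z hz
    have := ((hasDerivAt_id z).const_sub (p : ℂ)).clog hz
    refine this.congr_deriv ?_
    simp only [id]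
    rw [← neg_sub (p : ℂ) z, inv_neg, neg_div, one_div]
  unfold rectIntegral
  rw [integral_horizontal (F := fun z => (z - p)⁻¹) (f := fun z => log (z - p))
      (fun x _ => hd _ (Or.inr (by simp [hy.ne']))) c1,
    integral_horizontal (F := fun z => (z - p)⁻¹) (f := fun z => log (z - p))
      (fun x _ => hd _ (Or.inr (by simp [hy.ne']))) c2,
    integral_vertical (F := fun z => (z - p)⁻¹) (f := fun z => log (z - p))
      (fun x _ => hd _ (Or.inl (by simp; linarith))) c3,
    integral_vertical (F := fun z => (z - p)⁻¹) (f := fun z => log (p - z))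
      (fun x _ => hd' _ (Or.inl (by simp; linarith))) c4]
  set w : ℂ := R + p + y * I with hw
  set w' : ℂ := R + p - y * I with hw'
  have hw1 : log (-w) = log w - Real.pi * I := log_neg_of_im_pos (by simp [hw, hy])
  have hw2 : log (-w') = log w' + Real.pi * I := log_neg_of_im_neg (by simp [hw', hy])
  have e1 : ((-R : ℝ) + (-y : ℝ) * I - p : ℂ) = -w := by rw [hw]; push_cast; ring
  have e2 : ((-R : ℝ) + y * I - p : ℂ) = -w' := by rw [hw']; push_cast; ring
  have e3 : (p - ((-R : ℝ) + y * I) : ℂ) = w' := by rw [hw']; push_cast; ring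
  have e4 : (p - ((-R : ℝ) + (-y : ℝ) * I) : ℂ) = w := by rw [hw]; push_cast; ring
  rw [e1, e2, e3, e4, hw1, hw2]
  ring

lemma rectIntegral_inv_sub_pow {R y p : ℝ} (hy : 0 < y) (hp : |p| < R) (n : ℕ) :
    rectIntegral R y (fun z => ((z - p) ^ (n + 2))⁻¹) = 0 := by
  have hR : 0 ≤ R := (abs_nonneg p).trans hp.le
  have hne : ∀ z ∈ rectBoundary R y, z - p ≠ 0 :=
    fun z hz => sub_ne_zero_of_mem_rectBoundary hy hp hz
  refine rectIntegral_of_hasDerivAt hR hy.le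
    (f := fun z => -((n + 1 : ℂ))⁻¹ * ((z - p) ^ (n + 1))⁻¹) (fun z hz => ?_)
    (ContinuousOn.inv₀ (by fun_prop) fun z hz => pow_ne_zero _ (hne z hz))
  have h0 := hne z hz
  have h1 := ((((hasDerivAt_id z).sub_const (p : ℂ)).pow (n + 1)).inv
    (pow_ne_zero _ h0)).const_mul (-((n + 1 : ℂ))⁻¹)
  refine h1.congr_deriv ?_
  have h2 : (n + 1 : ℂ) ≠ 0 := by exact_mod_cast n.succ_ne_zero
  simp only [id, Pi.pow_apply]
  push_cast
  field_simp
  ring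

/-- The principal part `c₀/(z-p) + c₁/(z-p)² + c₂/(z-p)³`. -/
def principalPart (p : ℝ) (c : Fin 3 → ℂ) (z : ℂ) : ℂ :=
  c 0 * (z - p)⁻¹ + c 1 * ((z - p) ^ 2)⁻¹ + c 2 * ((z - p) ^ 3)⁻¹

lemma differentiableAt_principalPart {p : ℝ} {c : Fin 3 → ℂ} {z : ℂ} (hz : z ≠ p) :
    DifferentiableAt ℂ (principalPart p c) z := by
  have h0 : z - p ≠ 0 := sub_ne_zero.mpr hz
  have h2 := pow_ne_zero 2 h0
  have h3 := pow_ne_zero 3 h0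
  unfold principalPart
  fun_prop (disch := assumption)

lemma rectIntegral_principalPart {R y p : ℝ} (hy : 0 < y) (hp : |p| < R) (c : Fin 3 → ℂ) :
    rectIntegral R y (principalPart p c) = 2 * Real.pi * I * c 0 := by
  have hR : 0 ≤ R := (abs_nonneg p).trans hp.le
  have hne : ∀ z ∈ rectBoundary R y, z - p ≠ 0 :=
    fun z hz => sub_ne_zero_of_mem_rectBoundary hy hp hz
  have k1 : ContinuousOn (fun z : ℂ => c 0 * (z - p)⁻¹) (rectBoundary R y) :=
    continuousOn_const.mul (ContinuousOn.inv₀ (by fun_prop) hne)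
  have k : ∀ n (a : ℂ), ContinuousOn (fun z : ℂ => a * ((z - p) ^ n)⁻¹) (rectBoundary R y) :=
    fun n a => continuousOn_const.mul
      (ContinuousOn.inv₀ (by fun_prop) fun z hz => pow_ne_zero _ (hne z hz))
  unfold principalPart
  rw [rectIntegral_add (F := fun z => c 0 * (z - p)⁻¹ + c 1 * ((z - p) ^ 2)⁻¹) hR hy.le
      (k1.add (k 2 _)) (k 3 _), rectIntegral_add hR hy.le k1 (k 2 _),
    rectIntegral_const_mul, rectIntegral_const_mul, rectIntegral_const_mul,
    rectIntegral_inv_sub hy hp, rectIntegral_inv_sub_pow hy hp 0, rectIntegral_inv_sub_pow hy hp 1]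
  ring

/-- The residue theorem on a rectangle for a function with finitely many real poles of order at
most three. -/
theorem rectIntegral_eq_sum_residues {R y : ℝ} (hy : 0 < y) {U : Set ℂ} (hU : IsOpen U)
    (hRU : uIcc (-R) R ×ℂ uIcc (-y) y ⊆ U) {s : Finset ℝ} (hs : ∀ p ∈ s, |p| < R) (hR : 0 ≤ R)
    {F : ℂ → ℂ} (hF : ∀ z ∈ U, (∀ p ∈ s, z ≠ (p : ℝ)) → DifferentiableAt ℂ F z)
    (c : ℝ → Fin 3 → ℂ)
    (hc : ∀ p ∈ s, (fun z => F z - principalPart p (c p) z) =O[𝓝[≠] (p : ℂ)] fun _ => (1 : ℝ)) :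
    rectIntegral R y F = 2 * Real.pi * I * ∑ p ∈ s, c p 0 := by
  -- Subtracting all principal parts leaves only removable singularities, so Cauchy's theorem
  -- disposes of the remainder and each principal part contributes its first coefficient.
  classical
  set Q : ℂ → ℂ := fun z => F z - ∑ p ∈ s, principalPart p (c p) z with hQ
  set T : Set ℂ := (fun p : ℝ => (p : ℂ)) '' (s : Set ℝ) with hT
  have hTfin : T.Finite := s.finite_toSet.image _
  have hQd : ∀ z ∈ U \ T, DifferentiableAt ℂ Q z := by
    intro z hz
    have hne : ∀ p ∈ s, z ≠ (p : ℝ) := fun p hp h => hz.2 ⟨p, hp, h.symm⟩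
    exact (hF z hz.1 hne).sub (DifferentiableAt.fun_sum fun p hp =>
      differentiableAt_principalPart (hne p hp))
  have hopen : ∀ p : ℂ, ∀ᶠ z in 𝓝[≠] p, z ∉ T := by
    intro p
    have h1 : (T \ {p})ᶜ ∈ 𝓝 p := (hTfin.subset sdiff_subset).isClosed.isOpen_compl.mem_nhds (by simp)
    filter_upwards [nhdsWithin_le_nhds h1, self_mem_nhdsWithin] with z hz hzp hzT
    exact hz ⟨hzT, hzp⟩
  have hsR : ∀ p ∈ s, (p : ℂ) ∈ U := fun p hp => hRU (by
    have := abs_lt.mp (hs p hp)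
    rw [mem_reProdIm]
    constructor
    · simpa [uIcc_of_le (show -R ≤ R by linarith)] using ⟨this.1.le, this.2.le⟩
    · simp [hy.le])
  have hlim : ∀ p ∈ s, ∃ l, Tendsto Q (𝓝[≠] (p : ℂ)) (𝓝 l) := by
    intro p hp
    refine ⟨_, tendsto_limUnder_of_differentiable_on_punctured_nhds_of_bounded_under ?_ ?_⟩
    · filter_upwards [hopen p, nhdsWithin_le_nhds (hU.mem_nhds (hsR p hp))] with z hz hzU
      exact hQd z ⟨hzU, hz⟩
    · have h1 : (fun z => ∑ p' ∈ s.erase p, principalPart p' (c p') z)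
          =O[𝓝[≠] (p : ℂ)] fun _ => (1 : ℝ) := by
        have : ContinuousAt (fun z => ∑ p' ∈ s.erase p, principalPart p' (c p') z) (p : ℂ) :=
          tendsto_finsetSum _ fun p' hp' => (differentiableAt_principalPart (by
            simpa using (Finset.ne_of_mem_erase hp').symm)).continuousAt
        exact (this.norm.isBoundedUnder_le.isBigO_one ℝ).mono nhdsWithin_le_nhds
      -- The removable singularity theorem asks for boundedness of the difference from the value at
      -- the point; that value is arbitrary here and only adds a constant.
      have h2 : (fun z => Q z - Q p) =O[𝓝[≠] (p : ℂ)] fun _ => (1 : ℝ) := by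
        refine IsBigO.sub ?_ (isBigO_const_const _ one_ne_zero _)
        refine ((hc p hp).sub h1).congr_left fun z => ?_
        rw [hQ]
        simp only
        rw [← Finset.add_sum_erase s _ hp]
        ring
      exact h2.isBoundedUnder_le.mono_le (Eventually.of_forall fun z => by simp) |> fun h => h
  choose! l hl using hlim
  -- `G` is `Q` with the limit values filled in. Continuity at the finitely many poles is enough for
  -- the form of Cauchy's theorem that allows a countable exceptional set.
  set G : ℂ → ℂ := fun z => if z ∈ T then l z.re else Q z with hG
  have hGeq : ∀ p : ℂ, G =ᶠ[𝓝[≠] p] Q := fun p => (hopen p).mono fun z hz => by simp [hG, hz]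
  have hGcont : ∀ z ∈ U, ContinuousAt G z := by
    intro z hz
    rw [continuousAt_iff_punctured_nhds]
    by_cases hzT : z ∈ T
    · obtain ⟨p, hp, rfl⟩ := hzT
      have : G p = l p := by
        have : (p : ℂ) ∈ T := ⟨p, hp, rfl⟩
        simp [hG, this]
      rw [this]
      exact (hl p hp).congr' (hGeq _).symm
    · have : G z = Q z := by simp [hG, hzT]
      rw [this]
      exact ((hQd z ⟨hz, hzT⟩).continuousAt.tendsto.mono_left nhdsWithin_le_nhds).congr'
        (hGeq _).symm
  have hGd : ∀ z ∈ U \ T, DifferentiableAt ℂ G z := by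
    intro z hz
    refine (hQd z hz).congr_of_eventuallyEq ?_
    filter_upwards [hTfin.isClosed.isOpen_compl.mem_nhds hz.2] with x hx
    simp [hG, show x ∉ T from hx]
  have hG0 : rectIntegral R y G = 0 := by
    have := integral_boundary_rect_eq_zero_of_differentiable_on_off_countable G
      (⟨-R, -y⟩ : ℂ) (⟨R, y⟩ : ℂ) T hTfin.countable
      (fun z hz => (hGcont z (hRU hz)).continuousWithinAt)
      (fun z hz => hGd z ⟨hRU ?_, hz.2⟩)
    · exact this
    · obtain ⟨h1, h2⟩ := hz.1
      exact ⟨Ioo_subset_Icc_self h1, Ioo_subset_Icc_self h2⟩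
  have hbT : ∀ z ∈ rectBoundary R y, z ∉ T := by
    rintro z hz ⟨p, hp, rfl⟩
    exact sub_ne_zero_of_mem_rectBoundary hy (hs p hp) hz (sub_self _)
  have hbU : rectBoundary R y ⊆ U := fun z hz => hRU (by
    rw [mem_reProdIm, uIcc_of_le (by linarith), uIcc_of_le (by linarith)]
    exact ⟨abs_le.mp hz.1, abs_le.mp hz.2.1⟩)
  have hpp : ∀ p ∈ s, ContinuousOn (principalPart p (c p)) (rectBoundary R y) :=
    fun p hp z hz => (differentiableAt_principalPart (sub_ne_zero.mp
      (sub_ne_zero_of_mem_rectBoundary hy (hs p hp) hz))).continuousAt.continuousWithinAt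
  have h1 : rectIntegral R y F =
      rectIntegral R y (fun z => G z + ∑ p ∈ s, principalPart p (c p) z) := by
    refine rectIntegral_congr hR hy.le fun z hz => ?_
    simp [hG, hbT z hz, hQ]
  rw [h1, rectIntegral_add hR hy.le (fun z hz => (hGcont z (hbU hz)).continuousWithinAt)
    (continuousOn_finsetSum _ hpp), rectIntegral_sum hR hy.le s hpp, hG0, zero_add,
    Finset.mul_sum]
  exact Finset.sum_congr rfl fun p hp => rectIntegral_principalPart hy (hs p hp) _

end Residue

/-! ### Residues of the sinc kernel. -/

section SincKernel
open Complex Asymptotics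

/-- Dividing the Taylor bound for sin by |sin u| ≥ |u|/2. Cubic precision is what a triple pole
requires. -/
lemma div_sin_sub_isBigO :
    (fun u : ℂ => u / sin u - (1 + u ^ 2 / 6)) =O[𝓝[≠] 0] fun u => u ^ 3 := by
  refine IsBigO.of_bound 10 ?_
  have h1 : ∀ᶠ u : ℂ in 𝓝[≠] 0, ‖u‖ < 1 / 2 := nhdsWithin_le_nhds (by
    filter_upwards [Metric.ball_mem_nhds (0 : ℂ) (show (0:ℝ) < 1 / 2 by norm_num)] with u hu
    simpa using hu)
  filter_upwards [h1, self_mem_nhdsWithin] with u hu hu0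
  have hu0 : u ≠ 0 := hu0
  have hn : 0 < ‖u‖ := norm_pos_iff.mpr hu0
  set ρ := sin u - (u - u ^ 3 / 6) with hρ
  have hb : ‖ρ‖ ≤ ‖u‖ ^ 5 / 100 := sin_bound (by linarith)
  have hs : sin u = u - u ^ 3 / 6 + ρ := by rw [hρ]; ring
  have h2 : ‖u‖ ^ 2 ≤ 1 / 4 := by nlinarith
  have h4 : ‖u‖ ^ 4 ≤ 1 / 16 := by nlinarith [sq_nonneg (‖u‖ ^ 2)]
  have hsn : ‖u‖ / 2 ≤ ‖sin u‖ := by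
    have e : u = sin u + (u ^ 3 / 6 - ρ) := by rw [hs]; ring
    have t1 : ‖u‖ ≤ ‖sin u‖ + ‖u ^ 3 / 6 - ρ‖ := by
      conv_lhs => rw [e]
      exact norm_add_le _ _
    have t2 : ‖u ^ 3 / 6 - ρ‖ ≤ ‖u‖ ^ 3 / 6 + ‖u‖ ^ 5 / 100 := by
      refine (norm_sub_le _ _).trans (add_le_add (le_of_eq ?_) hb)
      simp
    have t3 : ‖u‖ ^ 3 / 6 + ‖u‖ ^ 5 / 100 ≤ ‖u‖ / 2 := by
      nlinarith [mul_le_mul_of_nonneg_left h2 hn.le, mul_le_mul_of_nonneg_left h4 hn.le]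
    linarith
  have hs0 : sin u ≠ 0 := by
    intro h0; rw [h0, norm_zero] at hsn; linarith
  have e : u / sin u - (1 + u ^ 2 / 6) = (u ^ 5 / 36 - (1 + u ^ 2 / 6) * ρ) / sin u := by
    rw [eq_div_iff hs0, sub_mul, div_mul_cancel₀ _ hs0, hs]; ring
  have hN : ‖u ^ 5 / 36 - (1 + u ^ 2 / 6) * ρ‖ ≤ ‖u‖ ^ 5 := by
    have t1 : ‖(1 + u ^ 2 / 6 : ℂ)‖ ≤ 2 := by
      refine (norm_add_le _ _).trans ?_
      simp only [norm_one, norm_div, norm_pow]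
      norm_num
      linarith
    calc ‖u ^ 5 / 36 - (1 + u ^ 2 / 6) * ρ‖ ≤ ‖u ^ 5 / 36‖ + ‖(1 + u ^ 2 / 6) * ρ‖ :=
          norm_sub_le _ _
      _ ≤ ‖u‖ ^ 5 / 36 + 2 * (‖u‖ ^ 5 / 100) := by
          rw [norm_mul]
          gcongr
          simp
      _ ≤ ‖u‖ ^ 5 := by nlinarith [pow_pos hn 5]
  rw [e, norm_div, norm_pow, div_le_iff₀ (norm_pos_iff.mpr hs0)]
  have : ‖u‖ ^ 5 ≤ 10 * ‖u‖ ^ 3 * (‖u‖ / 2) := by nlinarith [pow_pos hn 4]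
  exact hN.trans (this.trans (by gcongr))

/-- `u / sin u` with `u = π (z - p) / h`. -/
def cscFactor (h p : ℝ) (z : ℂ) : ℂ :=
  Real.pi / h * (z - p) / sin (Real.pi / h * (z - p))

lemma cscFactor_sub_isBigO {h : ℝ} (hh : 0 < h) (p : ℝ) :
    (fun z => cscFactor h p z - (1 + (Real.pi / h) ^ 2 / 6 * (z - p) ^ 2))
      =O[𝓝[≠] (p : ℂ)] fun z => (z - p) ^ 3 := by
  have hc : (Real.pi / h : ℂ) ≠ 0 :=
    div_ne_zero (by exact_mod_cast Real.pi_ne_zero) (by exact_mod_cast hh.ne')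
  have ht : Tendsto (fun z : ℂ => (Real.pi / h : ℂ) * (z - p)) (𝓝[≠] (p : ℂ)) (𝓝[≠] 0) := by
    refine tendsto_nhdsWithin_iff.mpr ⟨?_, ?_⟩
    · have : ContinuousAt (fun z : ℂ => (Real.pi / h : ℂ) * (z - p)) p := by fun_prop
      have := this.tendsto
      simp only [sub_self, mul_zero] at this
      exact this.mono_left nhdsWithin_le_nhds
    · filter_upwards [self_mem_nhdsWithin] with z hz
      exact mul_ne_zero hc (sub_ne_zero.mpr hz)
  have h1 := div_sin_sub_isBigO.comp_tendsto ht
  have h2 : ((fun u : ℂ => u ^ 3) ∘ fun z : ℂ => (Real.pi / h : ℂ) * (z - p))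
      =O[𝓝[≠] (p : ℂ)] fun z => (z - p) ^ 3 := by
    simp only [Function.comp_def, mul_pow]
    exact isBigO_const_mul_self _ _ _
  refine (h1.trans h2).congr_left fun z => ?_
  simp only [Function.comp_def, cscFactor]
  ring

lemma sub_isBigO_one (p : ℂ) : (fun z : ℂ => z - p) =O[𝓝[≠] p] fun _ => (1 : ℂ) := by
  have : ContinuousAt (fun z : ℂ => z - p) p := by fun_prop
  exact (this.norm.isBoundedUnder_le.isBigO_one ℂ).mono nhdsWithin_le_nhds

lemma cscFactor_sub_one_isBigO {h : ℝ} (hh : 0 < h) (p : ℝ) :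
    (fun z => cscFactor h p z - 1) =O[𝓝[≠] (p : ℂ)] fun z => z - p := by
  have b := sub_isBigO_one (p : ℂ)
  have b2 : (fun z : ℂ => (z - p) ^ 2) =O[𝓝[≠] (p : ℂ)] fun z => z - p := by
    refine (b.mul (isBigO_refl (fun z : ℂ => z - p) _)).congr (fun z => by ring) fun z => by ring
  have b3 : (fun z : ℂ => (z - p) ^ 3) =O[𝓝[≠] (p : ℂ)] fun z => z - p := by
    refine (b.mul b2).congr (fun z => by ring) fun z => by ring
  refine (((cscFactor_sub_isBigO hh p).trans b3).add
    (b2.const_mul_left ((Real.pi / h : ℂ) ^ 2 / 6))).congr_left fun z => ?_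
  ring

lemma sub_taylor_two_isBigO {g : ℂ → ℂ} {p : ℂ} (hg : AnalyticAt ℂ g p) :
    (fun z => g z - (g p + deriv g p * (z - p) + deriv (deriv g) p / 2 * (z - p) ^ 2))
      =O[𝓝[≠] p] fun z => (z - p) ^ 3 := by
  have h1 := hg.hasFPowerSeriesAt.isBigO_sub_partialSum_pow 3
  have ht : Tendsto (fun z : ℂ => z - p) (𝓝[≠] p) (𝓝 0) := by
    have : ContinuousAt (fun z : ℂ => z - p) p := by fun_prop
    have := this.tendsto
    simp only [sub_self] at this
    exact this.mono_left nhdsWithin_le_nhds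
  have h2 := h1.comp_tendsto ht
  refine IsBigO.trans (h2.congr_left fun z => ?_) (IsBigO.of_norm_left ?_)
  · simp only [Function.comp_def, FormalMultilinearSeries.partialSum, Finset.sum_range_succ,
      Finset.sum_range_zero, FormalMultilinearSeries.ofScalars_apply_eq, iteratedDeriv_succ,
      iteratedDeriv_zero, Nat.factorial]
    simp
  · refine (isBigO_refl _ _).norm_left.congr_left fun z => by simp

/-- The integrand whose residues produce the sinc approximation of `g''(a)`. -/
def sincKernel (g : ℂ → ℂ) (h a : ℝ) (z : ℂ) : ℂ :=
  g z / ((z - a) ^ 2 * sin (Real.pi / h * z))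

lemma sin_shift {h p : ℝ} (hs : Real.sin (Real.pi / h * p) = 0) (z : ℂ) :
    sin (Real.pi / h * z) = Real.cos (Real.pi / h * p) * sin (Real.pi / h * (z - p)) := by
  have e : (Real.pi / h * z : ℂ) = Real.pi / h * (z - p) + ((Real.pi / h * p : ℝ) : ℂ) := by
    push_cast; ring
  rw [e, sin_add, ← ofReal_sin, ← ofReal_cos, hs]
  push_cast
  ring

/-- At a zero p of sin(πz/h) the cosine is ±1, hence its own inverse. This isolates the pole 1/(z-p)
from a factor that tends to 1. -/
lemma sincKernel_eq {g : ℂ → ℂ} {h a p : ℝ} (hh : 0 < h)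
    (hs : Real.sin (Real.pi / h * p) = 0) {z : ℂ} (hz : z ≠ p) :
    sincKernel g h a z = Real.cos (Real.pi / h * p) * (h / Real.pi) *
      (g z / (z - a) ^ 2 * cscFactor h p z / (z - p)) := by
  have hc : (Real.cos (Real.pi / h * p) : ℂ) ^ 2 = 1 := by
    have := Real.sin_sq_add_cos_sq (Real.pi / h * p)
    rw [hs] at this
    have h2 : Real.cos (Real.pi / h * p) ^ 2 = 1 := by linarith
    exact_mod_cast h2
  have hπ : (Real.pi : ℂ) ≠ 0 := by exact_mod_cast Real.pi_ne_zero
  have hh' : (h : ℂ) ≠ 0 := by exact_mod_cast hh.ne'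
  have hz' : z - p ≠ 0 := sub_ne_zero.mpr hz
  rw [sincKernel, cscFactor, sin_shift hs]
  set c : ℂ := (Real.cos (Real.pi / h * p) : ℂ)
  set s := sin (Real.pi / h * (z - p))
  have hc0 : c ≠ 0 := by intro h0; rw [h0] at hc; norm_num at hc
  have hci : c⁻¹ = c := by
    rw [inv_eq_iff_eq_inv]; field_simp; exact hc
  have e : Real.pi / h * (z - p) / s / (z - p) = Real.pi / h / s := by field_simp
  calc g z / ((z - a) ^ 2 * (c * s)) = c⁻¹ * (g z / (z - a) ^ 2 / s) := by
        simp only [div_eq_mul_inv, mul_inv]; ring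
    _ = c * (h / Real.pi) * (g z / (z - a) ^ 2 * (Real.pi / h / s)) := by
        rw [hci]
        have : (h / Real.pi : ℂ) * (Real.pi / h) = 1 := by field_simp
        linear_combination (-(c * (g z / (z - a) ^ 2 / s))) * this
    _ = _ := by rw [← e]; ring

lemma isBigO_one_of_isBigO_mul {f : ℂ → ℂ} {p : ℂ} {n : ℕ} {F : ℂ → ℂ} (c : ℂ)
    (hf : f =O[𝓝[≠] p] fun z => (z - p) ^ n)
    (hF : ∀ᶠ z in 𝓝[≠] p, F z = c * (f z / (z - p) ^ n)) :
    F =O[𝓝[≠] p] fun _ => (1 : ℝ) := by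
  have h1 : (fun z => f z / (z - p) ^ n) =O[𝓝[≠] p] fun _ => (1 : ℝ) := by
    refine ((hf.mul (isBigO_refl (fun z => ((z - p) ^ n)⁻¹) _))).congr' ?_ ?_ |>.trans
      (isBigO_const_const (1 : ℂ) one_ne_zero _)
    · exact Eventually.of_forall fun z => (div_eq_mul_inv _ _).symm
    · filter_upwards [self_mem_nhdsWithin] with z hz
      exact mul_inv_cancel₀ (pow_ne_zero n (sub_ne_zero.mpr hz))
  exact (h1.const_mul_left c).congr' (hF.mono fun z hz => hz.symm) EventuallyEq.rfl

/-- Away from a the pole is simple, so first-order expansions suffice. -/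
lemma sincKernel_sub_principalPart_of_ne {g : ℂ → ℂ} {h a p : ℝ} (hh : 0 < h) (hpa : p ≠ a)
    (hs : Real.sin (Real.pi / h * p) = 0) (hg : AnalyticAt ℂ g p) :
    (fun z => sincKernel g h a z - principalPart p
      ![Real.cos (Real.pi / h * p) * (h / Real.pi) * (g p / (p - a) ^ 2), 0, 0] z)
      =O[𝓝[≠] (p : ℂ)] fun _ => (1 : ℝ) := by
  set f : ℂ → ℂ := fun z => g z / (z - a) ^ 2 with hf
  have hpa' : (p - a : ℂ) ≠ 0 := by exact_mod_cast sub_ne_zero.mpr hpa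
  have hfd : DifferentiableAt ℂ f p :=
    hg.differentiableAt.div (by fun_prop) (pow_ne_zero 2 hpa')
  have h1 : (fun z => f z - f p) =O[𝓝[≠] (p : ℂ)] fun z => z - p :=
    hfd.isBigO_sub.mono nhdsWithin_le_nhds
  have h2 : f =O[𝓝[≠] (p : ℂ)] fun _ => (1 : ℂ) :=
    (hfd.continuousAt.norm.isBoundedUnder_le.isBigO_one ℂ).mono nhdsWithin_le_nhds
  have h3 := h2.mul (cscFactor_sub_one_isBigO hh p)
  have h4 : (fun z => f z * cscFactor h p z - f p) =O[𝓝[≠] (p : ℂ)] fun z => (z - p) ^ 1 :=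
    (h1.add (h3.congr_right fun z => one_mul _)).congr (fun z => by ring) fun z => by ring
  refine isBigO_one_of_isBigO_mul (Real.cos (Real.pi / h * p) * (h / Real.pi)) h4 ?_
  filter_upwards [self_mem_nhdsWithin] with z hz
  rw [sincKernel_eq hh hs hz]
  simp only [principalPart, hf, Matrix.cons_val_zero, Matrix.cons_val_one, Matrix.cons_val]
  ring

/-- At a the double pole and the zero of the sine combine to order three. The residue is the
quadratic coefficient of g times u/sin u, which brings in g''(a). -/
lemma sincKernel_sub_principalPart_self {g : ℂ → ℂ} {h a : ℝ} (hh : 0 < h)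
    (hs : Real.sin (Real.pi / h * a) = 0) (hg : AnalyticAt ℂ g a) :
    (fun z => sincKernel g h a z - principalPart a
      ![Real.cos (Real.pi / h * a) * (h / Real.pi) *
          (deriv (deriv g) a / 2 + (Real.pi / h) ^ 2 / 6 * g a),
        Real.cos (Real.pi / h * a) * (h / Real.pi) * deriv g a,
        Real.cos (Real.pi / h * a) * (h / Real.pi) * g a] z)
      =O[𝓝[≠] (a : ℂ)] fun _ => (1 : ℝ) := by
  set κ : ℂ := (Real.pi / h : ℂ) ^ 2 / 6 with hκ
  set G : ℂ → ℂ := fun z => g a + deriv g a * (z - a) + deriv (deriv g) a / 2 * (z - a) ^ 2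
  set H : ℂ → ℂ := fun z => 1 + κ * (z - a) ^ 2
  have b1 := sub_taylor_two_isBigO hg
  have b2 := cscFactor_sub_isBigO hh a
  have b : ∀ {f : ℂ → ℂ}, ContinuousAt f a → f =O[𝓝[≠] (a : ℂ)] fun _ => (1 : ℂ) :=
    fun hf => (hf.norm.isBoundedUnder_le.isBigO_one ℂ).mono nhdsWithin_le_nhds
  have hG : G =O[𝓝[≠] (a : ℂ)] fun _ => (1 : ℂ) := b (by fun_prop)
  have hH : H =O[𝓝[≠] (a : ℂ)] fun _ => (1 : ℂ) := b (by fun_prop)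
  have hη : (fun z => cscFactor h a z) =O[𝓝[≠] (a : ℂ)] fun _ => (1 : ℂ) := by
    have : (fun z : ℂ => (z - a) ^ 3) =O[𝓝[≠] (a : ℂ)] fun _ => (1 : ℂ) := b (by fun_prop)
    exact ((b2.trans this).add hH).congr_left fun z => by ring
  -- The terms of degree three and four in the product of the two Taylor polynomials, divided by
  -- (z-a)³.
  have hl : (fun z : ℂ => κ * deriv g a + κ * (deriv (deriv g) a / 2) * (z - a))
      =O[𝓝[≠] (a : ℂ)] fun _ => (1 : ℂ) := b (by fun_prop)
  have h4 : (fun z => g z * cscFactor h a z -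
      (g a + deriv g a * (z - a) + (deriv (deriv g) a / 2 + κ * g a) * (z - a) ^ 2))
      =O[𝓝[≠] (a : ℂ)] fun z => (z - a) ^ 3 := by
    have e1 := (b1.mul hη).congr_right fun z => mul_one _
    have e2 := (hG.mul b2).congr_right fun z => one_mul _
    have e3 := (hl.mul (isBigO_refl (fun z : ℂ => (z - a) ^ 3) _)).congr_right fun z => one_mul _
    refine ((e1.add e2).add e3).congr_left fun z => ?_
    simp only [G]
    ring
  refine isBigO_one_of_isBigO_mul (Real.cos (Real.pi / h * a) * (h / Real.pi)) h4 ?_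
  filter_upwards [self_mem_nhdsWithin] with z hz
  have hz' : z - a ≠ 0 := sub_ne_zero.mpr hz
  rw [sincKernel_eq hh hs hz]
  simp only [principalPart, Matrix.cons_val_zero, Matrix.cons_val_one, Matrix.cons_val]
  field_simp
  ring

lemma sin_pi_div_mul_int {h : ℝ} (hh : 0 < h) (k : ℤ) : Real.sin (Real.pi / h * (k * h)) = 0 := by
  rw [show Real.pi / h * (k * h) = k * Real.pi by field_simp, Real.sin_int_mul_pi]

lemma cos_pi_div_mul_int {h : ℝ} (hh : 0 < h) (k : ℤ) :
    Real.cos (Real.pi / h * (k * h)) = (-1) ^ k := by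
  rw [show Real.pi / h * (k * h) = k * Real.pi by field_simp, Real.cos_int_mul_pi]

/-- The simple residues carry (-1)^k/(k-j)², which are the moments with nonzero index. The 1/6 from
u/sin u at the triple pole is half of `sincMoment 0`, so the diagonal term fits the same formula.
The half-integer width keeps the contour between the poles. -/
theorem rectIntegral_sincKernel {d : ℝ} {g : ℂ → ℂ} (hg : DifferentiableOn ℂ g (strip d))
    {h y R : ℝ} (hh : 0 < h) (hy : 0 < y) (hyd : y < d) {m : ℕ} (hR : R = (m + 1 / 2) * h)
    {j : ℤ} (hj : j ∈ Finset.Icc (-(m : ℤ)) m) :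
    rectIntegral R y (sincKernel g h (j * h)) = I * h * (-1) ^ j *
      (deriv (deriv g) ((j * h : ℝ) : ℂ) + (Real.pi / h) ^ 2 *
        ∑ k ∈ Finset.Icc (-(m : ℤ)) m, sincMoment (k - j) * g ((k * h : ℝ) : ℂ)) := by
  classical
  have hopen : IsOpen (strip d) := isOpen_lt (by fun_prop) continuous_const
  have hRpos : 0 ≤ R := by rw [hR]; positivity
  have hreal : ∀ p : ℝ, (p : ℂ) ∈ strip d := fun p => by
    simp [strip]; linarith
  have hga : ∀ p : ℝ, AnalyticAt ℂ g p := fun p => hg.analyticAt (hopen.mem_nhds (hreal p))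
  set a : ℝ := j * h with ha
  -- Wide enough to contain the closed rectangle, yet stopping short of the poles ±(m+1)h.
  set U : Set ℂ := strip d ∩ {z | |z.re| < (m + 1) * h} with hU
  have hUo : IsOpen U := hopen.inter (isOpen_lt (by fun_prop) continuous_const)
  have hinj : Function.Injective fun k : ℤ => (k : ℝ) * h := fun k l hkl => by
    have := mul_right_cancel₀ hh.ne' hkl
    exact_mod_cast this
  set s : Finset ℝ := (Finset.Icc (-(m : ℤ)) m).image fun k : ℤ => (k : ℝ) * h with hs
  have hsR : ∀ p ∈ s, |p| < R := by
    intro p hp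
    obtain ⟨k, hk, rfl⟩ := Finset.mem_image.mp hp
    rw [abs_mul, abs_of_pos hh, hR]
    refine mul_lt_mul_of_pos_right ?_ hh
    have : |k| ≤ m := abs_le.mpr (Finset.mem_Icc.mp hk)
    have : ((|k| : ℤ) : ℝ) ≤ m := by exact_mod_cast this
    push_cast at this
    linarith
  set c : ℝ → Fin 3 → ℂ := fun p => if p = a then
      ![Real.cos (Real.pi / h * a) * (h / Real.pi) *
          (deriv (deriv g) a / 2 + (Real.pi / h) ^ 2 / 6 * g a),
        Real.cos (Real.pi / h * a) * (h / Real.pi) * deriv g a,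
        Real.cos (Real.pi / h * a) * (h / Real.pi) * g a]
    else ![Real.cos (Real.pi / h * p) * (h / Real.pi) * (g p / (p - a) ^ 2), 0, 0] with hc
  have key := rectIntegral_eq_sum_residues hy hUo (s := s) (F := sincKernel g h a) ?_ hsR hRpos
    ?_ c ?_
  · rw [key, hs, Finset.sum_image fun k _ l _ hkl => hinj hkl, ← Finset.add_sum_erase _ _ hj]
    have e1 : c (j * h) 0 = (-1) ^ j * (h / Real.pi) *
        (deriv (deriv g) a / 2 + (Real.pi / h) ^ 2 / 6 * g a) := by
      simp only [hc, ha, if_true, cos_pi_div_mul_int hh, Matrix.cons_val_zero]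
      push_cast; rfl
    have hπ : (Real.pi : ℂ) ≠ 0 := by exact_mod_cast Real.pi_ne_zero
    have hh' : (h : ℂ) ≠ 0 := by exact_mod_cast hh.ne'
    have e2 : ∀ k ∈ (Finset.Icc (-(m : ℤ)) m).erase j, c (k * h) 0 =
        (-1) ^ j * (h / Real.pi) * ((Real.pi / h) ^ 2 / 2 *
          (sincMoment (k - j) * g ((k * h : ℝ) : ℂ))) := by
      intro k hk
      have hkj : k ≠ j := Finset.ne_of_mem_erase hk
      have hne : (k : ℝ) * h ≠ a := fun h0 => hkj (hinj h0)
      have hkj' : (k - j : ℂ) ≠ 0 := by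
        have := sub_ne_zero.mpr hkj
        exact_mod_cast this
      rw [hc]
      simp only [if_neg hne, cos_pi_div_mul_int hh, Matrix.cons_val_zero,
        sincMoment_of_ne_zero (sub_ne_zero.mpr hkj)]
      have hpow : ((-1 : ℂ)) ^ k = (-1) ^ j * (-1) ^ (k - j) := by
        rw [← zpow_add₀ (by norm_num)]; congr 1; ring
      rw [ha]
      push_cast
      rw [hpow, ← sub_mul]
      field_simp
    rw [e1, Finset.sum_congr rfl e2, ← Finset.mul_sum, ← Finset.mul_sum,
      ← Finset.add_sum_erase (Finset.Icc (-(m : ℤ)) m) (fun k : ℤ =>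
        (sincMoment (k - j) : ℂ) * g ((k * h : ℝ) : ℂ)) hj]
    simp only [sub_self, sincMoment_zero, ← ha]
    push_cast
    field_simp
    ring
  · intro z hz
    rw [mem_reProdIm, uIcc_of_le (by linarith), uIcc_of_le (by linarith)] at hz
    refine ⟨lt_of_le_of_lt (abs_le.mpr hz.2) hyd, lt_of_le_of_lt (abs_le.mpr hz.1) ?_⟩
    rw [hR]; nlinarith
  · intro z hz hne
    have hs0 : sin (Real.pi / h * z) ≠ 0 := by
      intro h0
      obtain ⟨k, hk⟩ := sin_eq_zero_iff.mp h0
      have hπ : (Real.pi : ℂ) ≠ 0 := by exact_mod_cast Real.pi_ne_zero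
      have hh' : (h : ℂ) ≠ 0 := by exact_mod_cast hh.ne'
      have hzk : z = ((k * h : ℝ) : ℂ) := by
        push_cast
        field_simp at hk
        linear_combination hk
      have h2 : |(k : ℝ)| < m + 1 := by
        have := hz.2
        rw [mem_ofPred_eq, hzk, ofReal_re, abs_mul, abs_of_pos hh] at this
        exact lt_of_mul_lt_mul_right this hh.le
      have h3 : |k| < m + 1 := by exact_mod_cast h2
      refine hne _ (Finset.mem_image.mpr ⟨k, ?_, rfl⟩) hzk
      rw [Finset.mem_Icc]
      constructor <;> [have := neg_abs_le k; have := le_abs_self k] <;> omega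
    have hza : z - a ≠ 0 := sub_ne_zero.mpr (hne a (Finset.mem_image.mpr ⟨j, hj, rfl⟩))
    exact (hg.differentiableAt (hopen.mem_nhds hz.1)).div (by fun_prop)
      (mul_ne_zero (pow_ne_zero 2 hza) hs0)
  · intro p hp
    obtain ⟨k, hk, rfl⟩ := Finset.mem_image.mp hp
    by_cases hka : (k : ℝ) * h = a
    · simp only [hc, hka, if_true]
      exact sincKernel_sub_principalPart_self hh (sin_pi_div_mul_int hh j) (hga a)
    · simp only [hc, hka, if_false]
      exact sincKernel_sub_principalPart_of_ne hh hka (sin_pi_div_mul_int hh k) (hga _)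

end SincKernel

/-! ### Bounds on the contour and the collocation error in the strip. -/

section SincBound
open Complex

lemma norm_sin_sq (x y : ℝ) :
    ‖sin (x + y * I)‖ ^ 2 = Real.sin x ^ 2 + Real.sinh y ^ 2 := by
  have e : sin (x + y * I) = ⟨Real.sin x * Real.cosh y, Real.cos x * Real.sinh y⟩ := by
    rw [sin_add_mul_I, ← ofReal_sin, ← ofReal_cos, ← ofReal_cosh, ← ofReal_sinh]
    apply Complex.ext <;>
      simp only [add_re, mul_re, ofReal_re, ofReal_im, I_re, I_im, mul_im, add_im] <;> ring
  rw [e, ← normSq_eq_norm_sq, normSq_mk]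
  have h1 := Real.cosh_sq y
  have h2 := Real.sin_sq_add_cos_sq x
  linear_combination (Real.sin x ^ 2) * h1 + Real.sinh y ^ 2 * h2

lemma integral_inv_sq_add_sq_le {y : ℝ} (hy : 0 < y) (a R : ℝ) :
    ∫ x in -R..R, ((x - a) ^ 2 + y ^ 2)⁻¹ ≤ Real.pi / y := by
  have hd : ∀ x ∈ uIcc (-R) R, HasDerivAt (fun x => Real.arctan ((x - a) / y) / y)
      (((x - a) ^ 2 + y ^ 2)⁻¹) x := by
    intro x _
    have h1 := ((((hasDerivAt_id x).sub_const a).div_const y).arctan).div_const y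
    refine h1.congr_deriv ?_
    simp only [id]
    field_simp
    ring
  rw [intervalIntegral.integral_eq_sub_of_hasDerivAt hd]
  · rw [← sub_div]
    gcongr
    linarith [Real.arctan_lt_pi_div_two ((R - a) / y),
      Real.neg_pi_div_two_lt_arctan ((-R - a) / y)]
  · exact (Continuous.inv₀ (by fun_prop) fun x => by positivity).intervalIntegrable _ _

/-- On these lines |sin(πz/h)| ≥ sinh(πy/h). The inequality 2GQ⁻¹ ≤ G² + Q⁻² then separates g from
the kernel, so only its L² norm enters. -/
lemma norm_sincKernel_horizontal_le {g : ℂ → ℂ} {h a x y η : ℝ} (hh : 0 < h) (hy : 0 < y)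
    (hη : |η| = y) :
    ‖sincKernel g h a (x + η * I)‖ ≤ (2 * Real.sinh (Real.pi * y / h))⁻¹ *
      (‖g (x + η * I)‖ ^ 2 + (y ^ 2)⁻¹ * ((x - a) ^ 2 + y ^ 2)⁻¹) := by
  set s := Real.sinh (Real.pi * y / h) with hs
  have hs0 : 0 < s := Real.sinh_pos_iff.mpr (by positivity)
  have hη2 : η ^ 2 = y ^ 2 := by rw [← hη, sq_abs]
  have h1 : s ≤ ‖sin (Real.pi / h * (x + η * I))‖ := by
    have e : (Real.pi / h * (x + η * I) : ℂ) =
        ((Real.pi / h * x : ℝ) : ℂ) + ((Real.pi / h * η : ℝ) : ℂ) * I := by push_cast; ring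
    have h2 : Real.sinh (Real.pi / h * η) ^ 2 = s ^ 2 := by
      rw [← sq_abs, Real.abs_sinh, abs_mul, hη, abs_of_pos (by positivity), hs]
      congr 2; ring
    rw [e]
    refine le_of_sq_le_sq ?_ (norm_nonneg _)
    rw [norm_sin_sq, h2]
    nlinarith [sq_nonneg (Real.sin (Real.pi / h * x))]
  set Q := (x - a) ^ 2 + y ^ 2 with hQ
  have hQ0 : 0 < Q := by positivity
  have h3 : ‖(x + η * I - a : ℂ) ^ 2‖ = Q := by
    rw [norm_pow, ← normSq_eq_norm_sq, normSq_apply, hQ, ← hη2]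
    simp; ring
  rw [sincKernel, norm_div, norm_mul, h3]
  set G := ‖g (x + η * I)‖
  have hG : 0 ≤ G := norm_nonneg _
  calc G / (Q * ‖sin (Real.pi / h * (x + η * I))‖) ≤ G / (Q * s) := by gcongr
    _ = (2 * s)⁻¹ * (2 * (G * Q⁻¹)) := by field_simp
    _ ≤ (2 * s)⁻¹ * (G ^ 2 + Q⁻¹ ^ 2) := by
        gcongr
        nlinarith [sq_nonneg (G - Q⁻¹)]
    _ ≤ _ := by
        gcongr
        rw [sq]
        gcongr
        rw [hQ]; nlinarith [sq_nonneg (x - a)]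

/-- At half-integer multiples of h the cosine vanishes, hence |sin| ≥ 1 on the whole line. The
factor (R-|a|)⁻² makes these sides negligible as R grows. -/
lemma norm_sincKernel_vertical_le {g : ℂ → ℂ} {h a R t ξ : ℝ} {m : ℕ} (hh : 0 < h)
    (hR : R = (m + 1 / 2) * h) (hξ : |ξ| = R) (ha : |a| < R) :
    ‖sincKernel g h a (ξ + t * I)‖ ≤ (2 * (R - |a|) ^ 2)⁻¹ *
      (‖g (ξ + t * I)‖ ^ 2 + 1) := by
  have h1 : 1 ≤ ‖sin (Real.pi / h * (ξ + t * I))‖ := by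
    have e : (Real.pi / h * (ξ + t * I) : ℂ) =
        ((Real.pi / h * ξ : ℝ) : ℂ) + ((Real.pi / h * t : ℝ) : ℂ) * I := by push_cast; ring
    have hc : Real.cos (Real.pi / h * ξ) = 0 := by
      rw [← Real.cos_abs, abs_mul, hξ, abs_of_pos (by positivity), hR]
      rw [Real.cos_eq_zero_iff]
      refine ⟨m, ?_⟩
      field_simp
      push_cast; ring
    have hs := Real.sin_sq_add_cos_sq (Real.pi / h * ξ)
    rw [hc] at hs
    rw [e]
    refine le_of_sq_le_sq ?_ (norm_nonneg _)
    rw [norm_sin_sq]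
    nlinarith [sq_nonneg (Real.sinh (Real.pi / h * t))]
  have hD : 0 < R - |a| := by linarith
  have h3 : (R - |a|) ^ 2 ≤ ‖(ξ + t * I - a : ℂ) ^ 2‖ := by
    rw [norm_pow]
    gcongr
    have h4 := abs_re_le_norm (ξ + t * I - a : ℂ)
    simp at h4
    have h5 := abs_sub_abs_le_abs_sub ξ a
    rw [hξ] at h5
    linarith
  rw [sincKernel, norm_div, norm_mul]
  set G := ‖g (ξ + t * I)‖
  have hG : 0 ≤ G := norm_nonneg _
  calc G / (‖(ξ + t * I - a : ℂ) ^ 2‖ * ‖sin (Real.pi / h * (ξ + t * I))‖)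
      ≤ G / ((R - |a|) ^ 2 * 1) := by gcongr
    _ = (2 * (R - |a|) ^ 2)⁻¹ * (2 * G) := by field_simp
    _ ≤ _ := by
        gcongr
        nlinarith [sq_nonneg (G - 1)]

lemma continuous_horizontal {d : ℝ} {g : ℂ → ℂ} (hg : DifferentiableOn ℂ g (strip d)) {η : ℝ}
    (hη : |η| < d) : Continuous fun x : ℝ => g (x + η * I) :=
  hg.continuousOn.comp_continuous (by fun_prop) fun x => by simpa [strip] using hη

lemma continuousOn_vertical {d : ℝ} {g : ℂ → ℂ} (hg : DifferentiableOn ℂ g (strip d)) {y : ℝ}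
    (hy0 : 0 ≤ y) (hy : y < d) (ξ : ℝ) :
    ContinuousOn (fun t : ℝ => g (ξ + t * I)) (uIcc (-y) y) :=
  hg.continuousOn.comp (by fun_prop) fun t ht => by
    have := abs_le_of_mem_uIcc_neg hy0 ht
    simp [strip]; linarith

lemma norm_rectIntegral_sincKernel_le {d : ℝ} {g : ℂ → ℂ} (hg : DifferentiableOn ℂ g (strip d))
    {h y R a C : ℝ} {m : ℕ} (hh : 0 < h) (hy : 0 < y) (hyd : y < d)
    (hR : R = (m + 1 / 2) * h) (ha : |a| < R)
    (h1 : ∫ x in -R..R, ‖g (x + (-y : ℝ) * I)‖ ^ 2 ≤ C)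
    (h2 : ∫ x in -R..R, ‖g (x + y * I)‖ ^ 2 ≤ C)
    (h3 : ∫ t in -y..y, ‖g (R + t * I)‖ ^ 2 ≤ C)
    (h4 : ∫ t in -y..y, ‖g ((-R : ℝ) + t * I)‖ ^ 2 ≤ C) :
    ‖rectIntegral R y (sincKernel g h a)‖ ≤
      (Real.sinh (Real.pi * y / h))⁻¹ * (C + Real.pi / y ^ 3) +
        ((R - |a|) ^ 2)⁻¹ * (C + 2 * y) := by
  have hR0 : 0 ≤ R := (abs_nonneg a).trans ha.le
  have hs0 : 0 < Real.sinh (Real.pi * y / h) := Real.sinh_pos_iff.mpr (by positivity)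
  have hD : 0 < R - |a| := by linarith
  have H : ∀ η : ℝ, |η| = y → ∫ x in -R..R, ‖g (x + η * I)‖ ^ 2 ≤ C →
      ‖∫ x in -R..R, sincKernel g h a (x + η * I)‖ ≤
        (2 * Real.sinh (Real.pi * y / h))⁻¹ * (C + Real.pi / y ^ 3) := by
    intro η hη hC
    have c1 : IntervalIntegrable (fun x : ℝ => ‖g (x + η * I)‖ ^ 2) MeasureTheory.volume (-R) R :=
      ((continuous_horizontal hg (hη.trans_lt hyd)).norm.pow 2).intervalIntegrable _ _
    have c2 : IntervalIntegrable (fun x : ℝ => (y ^ 2)⁻¹ * ((x - a) ^ 2 + y ^ 2)⁻¹)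
        MeasureTheory.volume (-R) R :=
      (continuous_const.mul
        (Continuous.inv₀ (by fun_prop) fun x => by positivity)).intervalIntegrable _ _
    refine (intervalIntegral.norm_integral_le_of_norm_le (by linarith)
      (Eventually.of_forall fun x _ => norm_sincKernel_horizontal_le hh hy hη)
      ((c1.add c2).const_mul _)).trans ?_
    rw [intervalIntegral.integral_const_mul, intervalIntegral.integral_add c1 c2,
      intervalIntegral.integral_const_mul]
    have e : Real.pi / y ^ 3 = (y ^ 2)⁻¹ * (Real.pi / y) := by field_simp
    rw [e]
    gcongr
    exact integral_inv_sq_add_sq_le hy a R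
  have V : ∀ ξ : ℝ, |ξ| = R → ∫ t in -y..y, ‖g (ξ + t * I)‖ ^ 2 ≤ C →
      ‖I • ∫ t in -y..y, sincKernel g h a (ξ + t * I)‖ ≤
        (2 * (R - |a|) ^ 2)⁻¹ * (C + 2 * y) := by
    intro ξ hξ hC
    have c1 : IntervalIntegrable (fun t : ℝ => ‖g (ξ + t * I)‖ ^ 2) MeasureTheory.volume (-y) y :=
      ((continuousOn_vertical hg hy.le hyd ξ).norm.pow 2).intervalIntegrable
    rw [norm_smul, norm_I, one_mul]
    refine (intervalIntegral.norm_integral_le_of_norm_le (by linarith)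
      (Eventually.of_forall fun t _ => norm_sincKernel_vertical_le hh hR hξ ha)
      ((c1.add intervalIntegrable_const).const_mul _)).trans ?_
    rw [intervalIntegral.integral_const_mul,
      intervalIntegral.integral_add c1 intervalIntegrable_const, intervalIntegral.integral_const]
    gcongr
    simp; linarith
  have n1 := H (-y) (by rw [abs_neg, abs_of_pos hy]) h1
  have n2 := H y (abs_of_pos hy) h2
  have n3 := V R (abs_of_nonneg hR0) h3
  have n4 := V (-R) (by rw [abs_neg, abs_of_nonneg hR0]) h4
  unfold rectIntegral
  refine (norm_sub_le _ _).trans ?_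
  refine (add_le_add_left ((norm_add_le _ _).trans (add_le_add_left (norm_sub_le _ _) _)) _).trans ?_
  rw [mul_inv] at n1 n2 n3 n4
  linarith

lemma integral_norm_sq_le_of_lintegral {u : ℝ → ℂ} {r C : ℝ} (hr : 0 ≤ r) (hC : 0 ≤ C)
    (hu : ContinuousOn u (Icc (-r) r))
    (h : ∫⁻ x in Ioo (-r) r, ‖u x‖ₑ ^ 2 ≤ ENNReal.ofReal C) :
    ∫ x in -r..r, ‖u x‖ ^ 2 ≤ C := by
  rw [intervalIntegral.integral_of_le (by linarith), MeasureTheory.integral_Ioc_eq_integral_Ioo,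
    MeasureTheory.integral_eq_lintegral_of_nonneg_ae (f := fun x => ‖u x‖ ^ 2)
      (Eventually.of_forall fun x => by positivity)
      (((hu.mono Ioo_subset_Icc_self).norm.pow 2).aestronglyMeasurable measurableSet_Ioo)]
  refine ENNReal.toReal_le_of_le_ofReal hC (le_of_eq_of_le ?_ h)
  congr 1
  ext x
  rw [ENNReal.ofReal_pow (norm_nonneg _), ofReal_norm]

/-- Convergence of the norms gives a bound near ε = 0 only; L + 1 is any number above the limit. -/
lemma MemB2.exists_bound {d : ℝ} {g : ℂ → ℂ} (hg : MemB2 d g) :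
    ∃ C : ℝ, 0 ≤ C ∧ ∀ᶠ ε in 𝓝[>] (0 : ℝ), rectBoundaryIntegral d g ε ≤ ENNReal.ofReal C := by
  obtain ⟨L, hL, ht⟩ := hg.norm_finite
  have h1 : ∀ᶠ ε in 𝓝[>] (0 : ℝ), rectBoundaryIntegral d g ε ^ (1 / 2 : ℝ) < L + 1 :=
    ht.eventually_lt_const (ENNReal.lt_add_right hL.ne one_ne_zero)
  refine ⟨((L + 1) ^ (2 : ℝ)).toReal, ENNReal.toReal_nonneg, ?_⟩
  filter_upwards [h1] with ε hε
  rw [ENNReal.ofReal_toReal (ENNReal.rpow_ne_top_of_nonneg (by norm_num) (by finiteness))]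
  have := ENNReal.rpow_le_rpow hε.le (show (0:ℝ) ≤ 2 by norm_num)
  rwa [← ENNReal.rpow_mul, show (1 / 2 * 2 : ℝ) = 1 by norm_num, ENNReal.rpow_one] at this

/-- The sinc collocation error for the second derivative of a function in the class `B₂`, with the
cardinal series truncated symmetrically. -/
theorem MemB2.exists_sinc_error {d : ℝ} (hd : 0 < d) {g : ℂ → ℂ} (hg : MemB2 d g) :
    ∃ C : ℝ, 0 ≤ C ∧ ∀ h : ℝ, 0 < h → ∀ j : ℤ, ∃ e : ℕ → ℝ,
      Tendsto e atTop (𝓝 (C * (h * Real.sinh (Real.pi * d / h))⁻¹)) ∧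
      ∀ᶠ m : ℕ in atTop, ‖deriv (deriv g) ((j * h : ℝ) : ℂ) + (Real.pi / h) ^ 2 *
        ∑ k ∈ Finset.Icc (-(m : ℤ)) m, sincMoment (k - j) * g ((k * h : ℝ) : ℂ)‖ ≤ e m := by
  obtain ⟨C, hC, hev⟩ := hg.exists_bound
  refine ⟨C + Real.pi / d ^ 3, by positivity, fun h hh j => ?_⟩
  -- With ε = 1/R these are exactly the exhausting rectangles of the B₂ norm, with vertical sides
  -- halfway between nodes.
  set R : ℕ → ℝ := fun m => (m + 1 / 2) * h with hR
  set y : ℕ → ℝ := fun m => d * (1 - (R m)⁻¹) with hy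
  set a : ℝ := j * h with ha
  have hRt : Tendsto R atTop atTop :=
    (tendsto_atTop_add_const_right _ _ tendsto_natCast_atTop_atTop).atTop_mul_const hh
  have hRi : Tendsto (fun m => (R m)⁻¹) atTop (𝓝 0) := tendsto_inv_atTop_zero.comp hRt
  have hyt : Tendsto y atTop (𝓝 d) := by
    have := (tendsto_const_nhds (x := (1:ℝ))).sub hRi |>.const_mul d
    simpa [hy] using this
  have hRi' : Tendsto (fun m => (R m)⁻¹) atTop (𝓝[>] 0) :=
    tendsto_nhdsWithin_iff.mpr ⟨hRi, Eventually.of_forall fun m => by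
      simp only [mem_Ioi, hR]; positivity⟩
  refine ⟨fun m => h⁻¹ * ((Real.sinh (Real.pi * y m / h))⁻¹ * (C + Real.pi / y m ^ 3) +
        ((R m - |a|) ^ 2)⁻¹ * (C + 2 * y m)), ?_, ?_⟩
  · have t1 : Tendsto (fun m => (Real.sinh (Real.pi * y m / h))⁻¹) atTop
        (𝓝 (Real.sinh (Real.pi * d / h))⁻¹) :=
      ((Real.continuous_sinh.tendsto _).comp ((hyt.const_mul Real.pi).div_const h)).inv₀
        (Real.sinh_pos_iff.mpr (by positivity)).ne'
    have t2 : Tendsto (fun m => C + Real.pi / y m ^ 3) atTop (𝓝 (C + Real.pi / d ^ 3)) :=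
      tendsto_const_nhds.add (tendsto_const_nhds.div (hyt.pow 3) (by positivity))
    -- The vertical sides disappear in the limit, leaving the hyperbolic sine term at full height d.
    have t3 : Tendsto (fun m => ((R m - |a|) ^ 2)⁻¹) atTop (𝓝 0) :=
      tendsto_inv_atTop_zero.comp ((tendsto_pow_atTop two_ne_zero).comp
        (tendsto_atTop_add_const_right _ (-|a|) hRt))
    have t4 : Tendsto (fun m => C + 2 * y m) atTop (𝓝 (C + 2 * d)) :=
      tendsto_const_nhds.add (hyt.const_mul 2)
    have := ((t1.mul t2).add (t3.mul t4)).const_mul h⁻¹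
    rw [zero_mul, add_zero, mul_left_comm, ← mul_assoc, mul_comm _ (C + _), ← mul_inv,
      mul_comm (Real.sinh _)] at this
    exact this
  · filter_upwards [hRi'.eventually hev, hyt.eventually_const_lt hd, hRt.eventually_gt_atTop |a|,
      eventually_ge_atTop j.natAbs] with m hm hy0 hRa hmj
    have hR0 : 0 < R m := by simp only [hR]; positivity
    have hyd : y m < d := by
      have : 0 < (R m)⁻¹ := inv_pos.mpr hR0
      simp only [hy]; nlinarith
    have hj : j ∈ Finset.Icc (-(m : ℤ)) m := by
      rw [Finset.mem_Icc]; omega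
    have hid := rectIntegral_sincKernel hg.analytic hh hy0 hyd (m := m) (R := R m) rfl hj
    have hsum := hm
    unfold rectBoundaryIntegral at hsum
    rw [one_div, inv_inv] at hsum
    have hmk : ∀ x t : ℝ, (⟨x, t⟩ : ℂ) = x + t * I := fun x t => mk_eq_add_mul_I x t
    simp only [hmk] at hsum
    have hyy : d * (1 - (R m)⁻¹) = y m := rfl
    rw [hyy] at hsum
    have s4 := le_of_add_le_right hsum
    have s3 := le_of_add_le_right (le_of_add_le_left hsum)
    have s2 := le_of_add_le_right (le_of_add_le_left (le_of_add_le_left hsum))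
    have s1 := le_of_add_le_left (le_of_add_le_left (le_of_add_le_left hsum))
    have hyabs : |y m| < d := by rwa [abs_of_pos hy0]
    have hyabs' : |-y m| < d := by rwa [abs_neg]
    have hv := fun ξ => continuousOn_vertical hg.analytic hy0.le hyd ξ
    rw [uIcc_of_le (by linarith)] at hv
    have hn := norm_rectIntegral_sincKernel_le hg.analytic hh hy0 hyd (m := m) (R := R m) rfl hRa
      (integral_norm_sq_le_of_lintegral hR0.le hC
        (continuous_horizontal hg.analytic hyabs').continuousOn s1)
      (integral_norm_sq_le_of_lintegral hR0.le hC
        (continuous_horizontal hg.analytic hyabs).continuousOn s2)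
      (integral_norm_sq_le_of_lintegral hy0.le hC (hv _) s4)
      (integral_norm_sq_le_of_lintegral hy0.le hC (hv _) s3)
    rw [hid, norm_mul, norm_mul, norm_mul, norm_I, norm_zpow, norm_neg, norm_one, one_zpow,
      norm_real, Real.norm_eq_abs, abs_of_pos hh, one_mul, mul_one] at hn
    rwa [le_inv_mul_iff₀ hh]

end SincBound

/-! ### The Lambert function and the number of nodes on each side. -/

lemma lambertW_spec {x : ℝ} (hx : 0 < x) :
    0 < lambertW x ∧ lambertW x * Real.exp (lambertW x) = x := by
  have hex : ∃ w ∈ Ici (-1 : ℝ), w * Real.exp w = x := by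
    have h1 : x ∈ Icc ((0 : ℝ) * Real.exp 0) (x * Real.exp x) :=
      ⟨by simpa using hx.le, le_mul_of_one_le_right hx.le (Real.one_le_exp hx.le)⟩
    obtain ⟨w, hw, hwx⟩ := intermediate_value_Icc hx.le
      (f := fun w : ℝ => w * Real.exp w) (by fun_prop) h1
    exact ⟨w, by simp only [mem_Ici]; linarith [hw.1], hwx⟩
  have h2 : lambertW x * Real.exp (lambertW x) = x := Function.invFunOn_eq hex
  refine ⟨?_, h2⟩
  by_contra h
  push Not at h
  nlinarith [Real.exp_pos (lambertW x)]

lemma tendsto_lambertW_atTop : Tendsto lambertW atTop atTop := by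
  refine tendsto_atTop.mpr fun T => ?_
  filter_upwards [eventually_gt_atTop 0, eventually_ge_atTop (|T| * Real.exp |T|)] with x hx hxT
  obtain ⟨h0, h1⟩ := lambertW_spec hx
  refine (le_abs_self T).trans ?_
  by_contra h
  push Not at h
  have : lambertW x * Real.exp (lambertW x) < |T| * Real.exp |T| :=
    mul_lt_mul'' h (Real.exp_lt_exp.mpr h) h0.le (Real.exp_pos _).le
  linarith

/-- From log x = log W + W and log W = o(W). -/
lemma tendsto_log_div_lambertW :
    Tendsto (fun x => Real.log x / lambertW x) atTop (𝓝 1) := by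
  have h1 : Tendsto (fun x => 1 + Real.log (lambertW x) / lambertW x) atTop (𝓝 1) := by
    have h2 : Tendsto (fun w : ℝ => Real.log w / w) atTop (𝓝 0) :=
      Real.isLittleO_log_id_atTop.tendsto_div_nhds_zero
    simpa using tendsto_const_nhds.add (h2.comp tendsto_lambertW_atTop)
  refine h1.congr' ?_
  filter_upwards [eventually_gt_atTop 0] with x hx
  obtain ⟨h0, h1⟩ := lambertW_spec hx
  have h2 : Real.log x = Real.log (lambertW x) + lambertW x := by
    conv_lhs => rw [← h1]
    rw [Real.log_mul h0.ne' (Real.exp_pos _).ne', Real.log_exp]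
  rw [h2]
  field_simp
  ring

lemma tendsto_const_mul_natCast_div {d γ β : ℝ} (hd : 0 < d) (hγ : 0 < γ) (hβ : 0 < β) :
    Tendsto (fun n : ℕ => Real.pi * d * γ * n / β) atTop atTop :=
  (tendsto_natCast_atTop_atTop.const_mul_atTop (by positivity)).atTop_div_const hβ

/-- The balance defining h: at node n the decay exponent equals πdγn. -/
lemma exp_mul_meshSize {d γ β : ℝ} (hd : 0 < d) (hγ : 0 < γ) (hβ : 0 < β) {n : ℕ} (hn : 0 < n) :
    β * Real.exp (γ * (n * meshSize d γ β n)) = Real.pi * d * γ * n := by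
  have hn' : (0 : ℝ) < n := by exact_mod_cast hn
  have e : γ * (n * meshSize d γ β n) = Real.log (Real.pi * d * γ * n / β) := by
    rw [meshSize]; field_simp
  rw [e, Real.exp_log (by positivity)]
  field_simp

lemma meshSize_pos {d γ β : ℝ} (hγ : 0 < γ) {n : ℕ} (hn : 0 < n)
    (h : 0 < Real.log (Real.pi * d * γ * n / β)) : 0 < meshSize d γ β n := by
  have hn' : (0 : ℝ) < n := by exact_mod_cast hn
  exact div_pos h (by positivity)

/-- With X = πdγ_a n/β_a, the unrounded count gives the exponent log X + log(β_a/β_b) log X/W(X). As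
log X/W(X) → 1, the decay exponent on the secondary side is asymptotic to πdγ_a n; the factor 1/2 is
a safety margin. -/
lemma eventually_secondary_points {d γa γb βa βb : ℝ} (hd : 0 < d) (hγa : 0 < γa) (hγb : 0 < γb)
    (hβa : 0 < βa) (hβb : 0 < βb) :
    ∀ᶠ n : ℕ in atTop,
      Real.pi * d * γa * n / 2 ≤ βb * Real.exp (γb * ((γa / γb * n *
        (1 + Real.log (βa / βb) / lambertW (Real.pi * d * γa * n / βa))) *
          meshSize d γa βa n)) ∧
      γa / γb * n * (1 + Real.log (βa / βb) / lambertW (Real.pi * d * γa * n / βa)) ≤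
        2 * (γa / γb) * n := by
  set c := Real.log (βa / βb) with hc
  have hX := tendsto_const_mul_natCast_div hd hγa hβa
  have t1 : Tendsto (fun n : ℕ => Real.exp (c * (Real.log (Real.pi * d * γa * n / βa) /
      lambertW (Real.pi * d * γa * n / βa)))) atTop (𝓝 (βa / βb)) := by
    have := ((tendsto_log_div_lambertW.comp hX).const_mul c)
    have := (Real.continuous_exp.tendsto _).comp this
    rwa [mul_one, hc, Real.exp_log (by positivity)] at this
  have t2 : Tendsto (fun n : ℕ => c / lambertW (Real.pi * d * γa * n / βa)) atTop (𝓝 0) :=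
    tendsto_const_nhds.div_atTop (tendsto_lambertW_atTop.comp hX)
  have hlt : βa / βb / 2 < βa / βb := half_lt_self (by positivity)
  filter_upwards [t1.eventually_const_lt hlt, t2.eventually_lt_const one_pos,
    eventually_gt_atTop 0] with n h1 h2 hn
  have hn' : (0 : ℝ) < n := by exact_mod_cast hn
  constructor
  · set X := Real.pi * d * γa * n / βa with hXdef
    have hX0 : 0 < X := by positivity
    have e : γb * ((γa / γb * n * (1 + c / lambertW X)) * meshSize d γa βa n) =
        Real.log X + c * (Real.log X / lambertW X) := by
      rw [meshSize, ← hXdef]; field_simp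
    rw [e, Real.exp_add, Real.exp_log hX0]
    calc Real.pi * d * γa * n / 2 = βb * (X * (βa / βb / 2)) := by rw [hXdef]; field_simp
      _ ≤ _ := by gcongr
  · have : 0 < γa / γb * n := by positivity
    nlinarith

/-- The shift by one refers to the first omitted node, and it compensates for the floor. The side
with n nodes follows from the balance of the mesh, the other from its asymptotics. -/
theorem eventually_points {d βL βR γL γR : ℝ} (hd : 0 < d) (hβL : 0 < βL) (hβR : 0 < βR)
    (hγL : 0 < γL) (hγR : 0 < γR) :
    ∃ C : ℝ, 0 < C ∧ ∀ᶠ n : ℕ in atTop,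
      Real.pi * d * max γL γR * n / 2 ≤
        βL * Real.exp (γL * ((leftPoints d βL βR γL γR n + 1) *
          meshSize d (max γL γR) (meshBeta βL βR γL γR) n)) ∧
      Real.pi * d * max γL γR * n / 2 ≤
        βR * Real.exp (γR * ((rightPoints d βL βR γL γR n + 1) *
          meshSize d (max γL γR) (meshBeta βL βR γL γR) n)) ∧
      (leftPoints d βL βR γL γR n + rightPoints d βL βR γL γR n + 1 : ℝ) ≤ C * n := by
  by_cases hcase : LeftCase βL βR γL γR
  · have hmax : max γL γR = γL := max_eq_left (by
      rcases hcase with h | h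
      · exact h.le
      · exact h.1.ge)
    simp only [leftPoints, rightPoints, meshBeta, if_pos hcase, hmax]
    -- n nodes on one side, at most 2(γL/γR)n + 1 on the other, and the origin; n ≥ 1 absorbs the
    -- constants.
    refine ⟨1 + 2 * (γL / γR) + 2, by positivity, ?_⟩
    have hX := Real.tendsto_log_atTop.comp (tendsto_const_mul_natCast_div hd hγL hβL)
    filter_upwards [eventually_secondary_points hd hγL hγR hβL hβR, eventually_gt_atTop 0,
      hX.eventually_gt_atTop 0] with n hn hn0 hlog
    have hn' : (1 : ℝ) ≤ n := by exact_mod_cast hn0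
    have hh := meshSize_pos hγL hn0 hlog
    refine ⟨?_, hn.1.trans ?_, ?_⟩
    · have h1 := exp_mul_meshSize hd hγL hβL hn0
      have h2 : Real.pi * d * γL * n / 2 ≤ Real.pi * d * γL * n := half_le_self (by positivity)
      refine (h2.trans h1.ge).trans ?_
      gcongr
      linarith
    · gcongr
      exact (Nat.le_ceil _).trans (by linarith)
    · set P := γL / γR * n *
        (1 + Real.log (βL / βR) / lambertW (Real.pi * d * γL * n / βL)) with hP
      have h1 : (⌈P⌉₊ : ℝ) ≤ 2 * (γL / γR) * n + 1 := by
        rcases le_or_gt 0 P with h | h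
        · linarith [Nat.ceil_lt_add_one h, hn.2]
        · rw [Nat.ceil_eq_zero.mpr h.le]; simp; positivity
      linarith
  · have hmax : max γL γR = γR := max_eq_right (by
      by_contra h
      exact hcase (Or.inl (not_le.mp h)))
    simp only [leftPoints, rightPoints, meshBeta, if_neg hcase, hmax]
    refine ⟨1 + 2 * (γR / γL) + 2, by positivity, ?_⟩
    have hX := Real.tendsto_log_atTop.comp (tendsto_const_mul_natCast_div hd hγR hβR)
    filter_upwards [eventually_secondary_points hd hγR hγL hβR hβL, eventually_gt_atTop 0,
      hX.eventually_gt_atTop 0] with n hn hn0 hlog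
    have hn' : (1 : ℝ) ≤ n := by exact_mod_cast hn0
    have hh := meshSize_pos hγR hn0 hlog
    refine ⟨hn.1.trans ?_, ?_, ?_⟩
    · gcongr
      exact (Nat.lt_floor_add_one _).le
    · have h1 := exp_mul_meshSize hd hγR hβR hn0
      have h2 : Real.pi * d * γR * n / 2 ≤ Real.pi * d * γR * n := half_le_self (by positivity)
      refine (h2.trans h1.ge).trans ?_
      gcongr
      linarith
    · set P := γR / γL * n *
        (1 + Real.log (βR / βL) / lambertW (Real.pi * d * γR * n / βR)) with hP
      have h1 : (⌊P⌋₊ : ℝ) ≤ 2 * (γR / γL) * n := by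
        rcases le_or_gt 0 P with h | h
        · exact (Nat.floor_le h).trans hn.2
        · rw [Nat.floor_of_nonpos h.le]; simp; positivity
      linarith

/-! ### Asymptotics of the mesh size -/

lemma tendsto_sqrt_natCast : Tendsto (fun n : ℕ => √(n : ℝ)) atTop atTop :=
  Real.tendsto_sqrt_atTop.comp tendsto_natCast_atTop_atTop

lemma eventually_log_le_sqrt {c : ℝ} (hc : 0 < c) :
    ∀ᶠ n : ℕ in atTop, Real.log (c * n) ≤ √n := by
  have h1 : Tendsto (fun s : ℝ => 2 * (Real.log s ^ 1 / s)) atTop (𝓝 (2 * 0)) :=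
    (Real.isLittleO_pow_log_id_atTop (n := 1)).tendsto_div_nhds_zero.const_mul 2
  have h2 := (h1.comp tendsto_sqrt_natCast).eventually_lt_const (show 2 * (0:ℝ) < 1 / 2 by norm_num)
  filter_upwards [h2, tendsto_sqrt_natCast.eventually_ge_atTop (2 * Real.log c),
    eventually_gt_atTop 0] with n h2 h3 hn
  have hn' : (0 : ℝ) < n := by exact_mod_cast hn
  have hs : 0 < √(n : ℝ) := Real.sqrt_pos.mpr hn'
  have e : Real.log n = 2 * Real.log √n := by
    conv_lhs => rw [← Real.sq_sqrt hn'.le]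
    rw [Real.log_pow]; norm_num
  simp only [Function.comp_apply, pow_one] at h2
  rw [← mul_div_assoc, div_lt_iff₀ hs] at h2
  rw [Real.log_mul hc.ne' hn'.ne', e]
  linarith

lemma eventually_mul_log_sq_le_sqrt (c : ℝ) :
    ∀ᶠ n : ℕ in atTop, c * Real.log n ^ 2 ≤ √n := by
  have h1 : Tendsto (fun s : ℝ => (4 * c) * (Real.log s ^ 2 / s)) atTop (𝓝 (4 * c * 0)) :=
    (Real.isLittleO_pow_log_id_atTop (n := 2)).tendsto_div_nhds_zero.const_mul _
  have h2 := (h1.comp tendsto_sqrt_natCast).eventually_lt_const (show 4 * c * (0:ℝ) < 1 by norm_num)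
  filter_upwards [h2, eventually_gt_atTop 0] with n h2 hn
  have hn' : (0 : ℝ) < n := by exact_mod_cast hn
  have hs : 0 < √(n : ℝ) := Real.sqrt_pos.mpr hn'
  have e : Real.log n = 2 * Real.log √n := by
    conv_lhs => rw [← Real.sq_sqrt hn'.le]
    rw [Real.log_pow]; norm_num
  simp only [Function.comp_apply] at h2
  rw [← mul_div_assoc, div_lt_iff₀ hs] at h2
  rw [e]
  linarith

lemma tendsto_pow_mul_exp_neg_mul {c : ℝ} (hc : 0 < c) (k : ℕ) :
    Tendsto (fun s : ℝ => s ^ k * Real.exp (-(c * s))) atTop (𝓝 0) := by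
  have h1 := (Real.tendsto_pow_mul_exp_neg_atTop_nhds_zero k).comp
    (tendsto_id.const_mul_atTop hc)
  have h2 := h1.const_mul ((c ^ k)⁻¹)
  rw [mul_zero] at h2
  refine h2.congr fun s => ?_
  simp only [Function.comp_apply, id, mul_pow]
  field_simp

/-- Since log(γ'n) ≤ √n eventually, the exponential is at most exp(-c√n), which beats every power of
n. -/
lemma tendsto_sq_mul_exp_neg_div_log {c γ' : ℝ} (hc : 0 < c) (hγ : 0 < γ') :
    Tendsto (fun n : ℕ => (n : ℝ) ^ 2 * Real.exp (-(c * n / Real.log (γ' * n)))) atTop (𝓝 0) := by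
  have h1 := (tendsto_pow_mul_exp_neg_mul hc 4).comp tendsto_sqrt_natCast
  have hlog : ∀ᶠ n : ℕ in atTop, 0 < Real.log (γ' * n) :=
    (Real.tendsto_log_atTop.comp
      (tendsto_natCast_atTop_atTop.const_mul_atTop hγ)).eventually_gt_atTop 0
  refine squeeze_zero' (Eventually.of_forall fun n => by positivity) ?_ h1
  filter_upwards [eventually_log_le_sqrt hγ, hlog] with n h2 h3
  have hn' : (0 : ℝ) ≤ n := n.cast_nonneg
  have hs := Real.sq_sqrt hn'
  simp only [Function.comp_apply]
  rw [show √(n : ℝ) ^ 4 = (n : ℝ) ^ 2 by rw [← hs, ← pow_mul, hs]]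
  gcongr
  rw [le_div_iff₀ h3]
  calc c * √n * Real.log (γ' * n) ≤ c * √n * √n := by gcongr
    _ = c * n := by rw [mul_assoc, Real.mul_self_sqrt hn']

lemma inv_sinh_le {x : ℝ} (hx : 1 ≤ x) : (Real.sinh x)⁻¹ ≤ 4 * Real.exp (-x) := by
  have h1 : 2 ≤ Real.exp x := by linarith [Real.add_one_le_exp x]
  have h2 : Real.exp (-x) ≤ Real.exp x / 2 := by
    have : Real.exp (-x) ≤ 1 := Real.exp_le_one_iff.mpr (by linarith)
    linarith
  have h3 : Real.exp x / 4 ≤ Real.sinh x := by rw [Real.sinh_eq]; linarith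
  calc (Real.sinh x)⁻¹ ≤ (Real.exp x / 4)⁻¹ := by
        gcongr
    _ = 4 * Real.exp (-x) := by rw [Real.exp_neg]; field_simp

/-! ### Truncation of the cardinal series. -/

/-- Because Zγh ≥ 1, each step beyond the first omitted node raises the exponent by at least 1. The
tail is therefore dominated by a geometric series of ratio 1/e ≤ 1/2. -/
lemma sum_tail_le {f : ℤ → ℝ} {A β γ h Z : ℝ} {N : ℕ} (hA : 0 ≤ A) (hγ : 0 < γ) (hh : 0 < h)
    (hf : ∀ k : ℤ, 0 ≤ k → |f k| ≤ A * Real.exp (-β * Real.exp (γ * (k * h))))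
    (hZ : Z ≤ β * Real.exp (γ * ((N + 1) * h))) (hZ1 : 1 ≤ Z * (γ * h)) {s : Finset ℤ}
    (hs : ∀ k ∈ s, (N : ℤ) < k) : ∑ k ∈ s, |f k| ≤ 2 * A * Real.exp (-Z) := by
  set l : ℤ → ℕ := fun k => (k - N - 1).toNat with hl
  have hkl : ∀ k ∈ s, (k : ℝ) = N + 1 + l k := by
    intro k hk
    have h1 := hs k hk
    have : k = N + 1 + (l k : ℤ) := by simp only [hl]; omega
    exact_mod_cast this
  have hZ0 : 0 ≤ Z := by
    by_contra h0
    push Not at h0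
    nlinarith [mul_pos hγ hh]
  have hterm : ∀ k ∈ s, |f k| ≤ A * Real.exp (-Z) * (1 / 2) ^ l k := by
    intro k hk
    have hk0 : 0 ≤ k := by have := hs k hk; omega
    refine (hf k hk0).trans ?_
    rw [mul_assoc]
    refine mul_le_mul_of_nonneg_left ?_ hA
    have h1 : Z + l k ≤ β * Real.exp (γ * (k * h)) := by
      rw [hkl k hk, show γ * ((N + 1 + l k : ℝ) * h) = γ * ((N + 1) * h) + γ * (l k * h) by ring,
        Real.exp_add, ← mul_assoc]
      calc Z + l k ≤ Z * (1 + γ * (l k * h)) := by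
            have := mul_le_mul_of_nonneg_right hZ1 (Nat.cast_nonneg (α := ℝ) (l k))
            nlinarith
        _ ≤ Z * Real.exp (γ * (l k * h)) := by
            gcongr
            linarith [Real.add_one_le_exp (γ * (l k * h))]
        _ ≤ _ := by gcongr
    have h2 : Real.exp (-(l k : ℝ)) ≤ (1 / 2) ^ l k := by
      rw [show -(l k : ℝ) = (l k : ℝ) * (-1) by ring, Real.exp_nat_mul]
      gcongr
      rw [Real.exp_neg, one_div]
      gcongr
      linarith [Real.add_one_le_exp 1]
    calc Real.exp (-β * Real.exp (γ * (k * h))) ≤ Real.exp (-Z + -(l k : ℝ)) := by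
          gcongr; linarith
      _ ≤ _ := by rw [Real.exp_add]; gcongr
  refine (Finset.sum_le_sum hterm).trans ?_
  rw [← Finset.mul_sum]
  have hinj : Set.InjOn l s := by
    intro k hk k' hk' h
    have h1 := hs k hk; have h2 := hs k' hk'
    simp only [hl] at h; omega
  have : ∑ k ∈ s, (1 / 2 : ℝ) ^ l k ≤ 2 := by
    rw [← Finset.sum_image (g := l) (f := fun n => (1 / 2 : ℝ) ^ n) hinj]
    exact (summable_geometric_two.sum_le_tsum _ fun _ _ => by positivity).trans_eq
      tsum_geometric_two
  calc A * Real.exp (-Z) * ∑ k ∈ s, (1 / 2 : ℝ) ^ l k ≤ A * Real.exp (-Z) * 2 := by gcongr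
    _ = _ := by ring

lemma DoubleExpDecay.sum_outside_le {v : ℝ → ℝ} {A βL βR γL γR h Z : ℝ} {M N : ℕ}
    (hv : DoubleExpDecay v A βL βR γL γR) (hA : 0 ≤ A) (hγL : 0 < γL) (hγR : 0 < γR) (hh : 0 < h)
    (hL : Z ≤ βL * Real.exp (γL * ((M + 1) * h))) (hR : Z ≤ βR * Real.exp (γR * ((N + 1) * h)))
    (hL1 : 1 ≤ Z * (γL * h)) (hR1 : 1 ≤ Z * (γR * h)) {s : Finset ℤ}
    (hs : ∀ k ∈ s, k ∉ Finset.Icc (-(M : ℤ)) N) :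
    ∑ k ∈ s, |v (k * h)| ≤ 4 * A * Real.exp (-Z) := by
  classical
  rw [← Finset.sum_filter_add_sum_filter_not s fun k => (N : ℤ) < k]
  have h1 : ∑ k ∈ s with (N : ℤ) < k, |v (k * h)| ≤ 2 * A * Real.exp (-Z) := by
    refine sum_tail_le (f := fun k => v (k * h)) hA hγR hh (fun k hk => ?_) hR hR1 fun k hk =>
      (Finset.mem_filter.mp hk).2
    have hk' : (0 : ℝ) ≤ k * h := mul_nonneg (by exact_mod_cast hk) hh.le
    simpa [abs_of_nonneg hk'] using hv.2 _ hk'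
  have h2 : ∑ k ∈ s with ¬ (N : ℤ) < k, |v (k * h)| ≤ 2 * A * Real.exp (-Z) := by
    have := sum_tail_le (f := fun k => v (-(k * h))) hA hγL hh (N := M)
      (s := (s.filter fun k => ¬ (N : ℤ) < k).image fun k => -k) (fun k hk => ?_) hL hL1
      fun k hk => ?_
    · rw [Finset.sum_image fun a _ b _ => neg_inj.mp] at this
      simpa using this
    · have hk' : (0 : ℝ) ≤ k * h := mul_nonneg (by exact_mod_cast hk) hh.le
      simpa [abs_of_nonneg hk'] using hv.1 (-(k * h)) (by linarith)
    · obtain ⟨l, hl, rfl⟩ := Finset.mem_image.mp hk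
      obtain ⟨hl1, hl2⟩ := Finset.mem_filter.mp hl
      have := hs l hl1
      rw [Finset.mem_Icc] at this
      omega
  linarith

lemma deriv_ofReal_eq {g : ℂ → ℂ} {v : ℝ → ℝ} {x : ℝ} (hg : DifferentiableAt ℂ g x)
    (hv : DifferentiableAt ℝ v x) (hgv : ∀ x : ℝ, g x = v x) : deriv g x = deriv v x := by
  have h1 := hg.hasDerivAt.comp_ofReal
  have h2 := hv.hasDerivAt.ofReal_comp
  simp only [hgv] at h1
  exact h1.unique h2

lemma isOpen_strip (d : ℝ) : IsOpen (strip d) := isOpen_lt (by fun_prop) continuous_const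

lemma ofReal_mem_strip {d : ℝ} (hd : 0 < d) (x : ℝ) : (x : ℂ) ∈ strip d := by simpa [strip] using hd

/-- Analyticity also makes v'' continuous, which the differential equation alone would not give
since its coefficients need not be continuous. -/
lemma RealMemB2.exists_sinc_error {d : ℝ} (hd : 0 < d) {v : ℝ → ℝ} (hv : RealMemB2 d v)
    (hv1 : Differentiable ℝ v) (hv2 : Differentiable ℝ (deriv v)) :
    Continuous (deriv (deriv v)) ∧ ∃ C : ℝ, 0 ≤ C ∧ ∀ h : ℝ, 0 < h → ∀ j : ℤ, ∃ e : ℕ → ℝ,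
      Tendsto e atTop (𝓝 (C * (h * Real.sinh (Real.pi * d / h))⁻¹)) ∧
      ∀ᶠ m : ℕ in atTop, |deriv (deriv v) (j * h) + (Real.pi / h) ^ 2 *
        ∑ k ∈ Finset.Icc (-(m : ℤ)) m, sincMoment (k - j) * v (k * h)| ≤ e m := by
  obtain ⟨g, hg, hgv⟩ := hv
  have hn : ∀ x : ℝ, strip d ∈ 𝓝 (x : ℂ) := fun x => (isOpen_strip d).mem_nhds (ofReal_mem_strip hd x)
  have hg1 : DifferentiableOn ℂ (deriv g) (strip d) := hg.analytic.deriv (isOpen_strip d)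
  have hg2 : DifferentiableOn ℂ (deriv (deriv g)) (strip d) := hg1.deriv (isOpen_strip d)
  have e1 : ∀ x : ℝ, deriv g x = deriv v x := fun x =>
    deriv_ofReal_eq (hg.analytic.differentiableAt (hn x)) (hv1 x) hgv
  have e2 : ∀ x : ℝ, deriv (deriv g) x = deriv (deriv v) x := fun x =>
    deriv_ofReal_eq (hg1.differentiableAt (hn x)) (hv2 x) e1
  constructor
  · have : Continuous fun x : ℝ => (deriv (deriv g) x).re :=
      Complex.continuous_re.comp (hg2.continuousOn.comp_continuous Complex.continuous_ofReal
        fun x => ofReal_mem_strip hd x)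
    simpa only [e2, Complex.ofReal_re] using this
  · obtain ⟨C, hC, H⟩ := hg.exists_sinc_error hd
    refine ⟨C, hC, fun h hh j => ?_⟩
    obtain ⟨e, he, hev⟩ := H h hh j
    refine ⟨e, he, hev.mono fun m hm => ?_⟩
    rw [e2] at hm
    simp only [hgv] at hm
    rw [← Real.norm_eq_abs, ← Complex.norm_real]
    exact_mod_cast hm

/-- The bound T on sums over finite sets outside the window is uniform, so the limit m → ∞ can be
taken with finite sums only, without the infinite cardinal series. -/
lemma abs_collocation_error_le {v : ℝ → ℝ} {y h L T : ℝ} {j : ℤ} {M N : ℕ} {e : ℕ → ℝ}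
    (he : Tendsto e atTop (𝓝 L))
    (hev : ∀ᶠ m : ℕ in atTop, |y + (Real.pi / h) ^ 2 *
        ∑ k ∈ Finset.Icc (-(m : ℤ)) m, sincMoment (k - j) * v (k * h)| ≤ e m)
    (hT : ∀ s : Finset ℤ, (∀ k ∈ s, k ∉ Finset.Icc (-(M : ℤ)) N) → ∑ k ∈ s, |v (k * h)| ≤ T) :
    |y + (Real.pi / h) ^ 2 *
        ∑ k ∈ Finset.Icc (-(M : ℤ)) N, sincMoment (k - j) * v (k * h)| ≤
      L + (Real.pi / h) ^ 2 * T := by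
  refine ge_of_tendsto (he.add_const ((Real.pi / h) ^ 2 * T)) ?_
  filter_upwards [hev, eventually_ge_atTop (max M N)] with m hm hmMN
  have hsub : Finset.Icc (-(M : ℤ)) N ⊆ Finset.Icc (-(m : ℤ)) m := by
    have h1 := le_of_max_le_left hmMN
    have h2 := le_of_max_le_right hmMN
    exact Finset.Icc_subset_Icc (by omega) (by omega)
  have hsum := Finset.sum_sdiff (f := fun k : ℤ => sincMoment (k - j) * v (k * h)) hsub
  set D := ∑ k ∈ Finset.Icc (-(m : ℤ)) m \ Finset.Icc (-(M : ℤ)) N, sincMoment (k - j) * v (k * h)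
  have hD : |D| ≤ T := by
    refine (Finset.abs_sum_le_sum_abs _ _).trans ((Finset.sum_le_sum fun k _ => ?_).trans
      (hT _ fun k hk => (Finset.mem_sdiff.mp hk).2))
    rw [abs_mul]
    exact mul_le_of_le_one_left (abs_nonneg _) (abs_sincMoment_le _)
  rw [← hsum] at hm
  set S := ∑ k ∈ Finset.Icc (-(M : ℤ)) N, sincMoment (k - j) * v (k * h)
  have h3 : y + (Real.pi / h) ^ 2 * S =
      (y + (Real.pi / h) ^ 2 * (D + S)) - (Real.pi / h) ^ 2 * D := by ring
  rw [h3]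
  refine (abs_sub _ _).trans (add_le_add hm ?_)
  rw [abs_mul, abs_of_nonneg (by positivity)]
  gcongr

lemma tendsto_meshSize {d γ β : ℝ} (hd : 0 < d) (hγ : 0 < γ) (hβ : 0 < β) :
    Tendsto (meshSize d γ β) atTop (𝓝 0) := by
  have h1 : Tendsto (fun x : ℝ => Real.pi * d / β * (Real.log x / x)) atTop
      (𝓝 (Real.pi * d / β * 0)) :=
    Real.isLittleO_log_id_atTop.tendsto_div_nhds_zero.const_mul _
  rw [mul_zero] at h1
  refine (h1.comp (tendsto_const_mul_natCast_div hd hγ hβ)).congr' ?_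
  filter_upwards [eventually_gt_atTop 0] with n hn
  have hn' : (0 : ℝ) < n := by exact_mod_cast hn
  simp only [Function.comp_apply, meshSize]
  field_simp

lemma pi_mul_div_meshSize {d γ β : ℝ} {n : ℕ} :
    Real.pi * d / meshSize d γ β n =
      Real.pi * d * γ * n / Real.log (Real.pi * d * γ * n / β) := by
  rw [meshSize, div_div_eq_mul_div]; ring

lemma eventually_error_bound_le {d γ β C A : ℝ} (hd : 0 < d) (hγ : 0 < γ) (hβ : 0 < β)
    (hC : 0 ≤ C) (hA : 0 ≤ A) :
    ∃ C₁ : ℝ, 0 < C₁ ∧ ∀ᶠ n : ℕ in atTop,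
      C * (meshSize d γ β n * Real.sinh (Real.pi * d / meshSize d γ β n))⁻¹ +
        (Real.pi / meshSize d γ β n) ^ 2 * (4 * A * Real.exp (-(Real.pi * d * γ * n / 2))) ≤
      C₁ * n * Real.exp (-(Real.pi * d * γ * n / Real.log (Real.pi * d * γ * n / β))) := by
  refine ⟨4 * C * γ + 4 * Real.pi ^ 2 * γ ^ 2 * A + 1, by positivity, ?_⟩
  have hlog := Real.tendsto_log_atTop.comp (tendsto_const_mul_natCast_div hd hγ hβ)
  have hsmall := ((tendsto_pow_mul_exp_neg_mul (c := Real.pi * d * γ / 4) (by positivity) 2).comp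
    (tendsto_natCast_atTop_atTop (R := ℝ))).eventually_le_const one_pos
  have hmesh := (tendsto_meshSize hd hγ hβ).eventually_lt_const
    (show 0 < Real.pi * d by positivity)
  -- Once the logarithm is at least 4, E ≤ πdγn/4, half of the truncation exponent; the other half
  -- kills the factor n² coming from h⁻².
  filter_upwards [hlog.eventually_ge_atTop 4, hsmall, hmesh, eventually_gt_atTop 0] with
    n hl hs hm hn
  have hn' : (1 : ℝ) ≤ n := by exact_mod_cast hn
  simp only [Function.comp_apply] at hl hs
  have hh := meshSize_pos (d := d) (β := β) hγ hn (by linarith)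
  have hinv : (meshSize d γ β n)⁻¹ ≤ γ * n := by
    rw [meshSize, inv_div]
    exact div_le_self (by positivity) (by linarith)
  rw [← pi_mul_div_meshSize]
  set h := meshSize d γ β n with hdef
  set E := Real.pi * d / h with hE
  have hE1 : 1 ≤ E := by rw [hE, one_le_div hh]; exact hm.le
  have hE2 : E ≤ Real.pi * d * γ / 4 * n := by
    rw [hE, hdef, pi_mul_div_meshSize]
    calc Real.pi * d * γ * n / Real.log (Real.pi * d * γ * n / β)
        ≤ Real.pi * d * γ * n / 4 := by gcongr
      _ = _ := by ring
  have t1 : C * (h * Real.sinh E)⁻¹ ≤ 4 * C * γ * n * Real.exp (-E) := by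
    rw [mul_inv]
    calc C * (h⁻¹ * (Real.sinh E)⁻¹) ≤ C * ((γ * n) * (4 * Real.exp (-E))) := by
          gcongr
          exact inv_sinh_le hE1
      _ = _ := by ring
  have t2 : (Real.pi / h) ^ 2 * (4 * A * Real.exp (-(Real.pi * d * γ * n / 2))) ≤
      4 * Real.pi ^ 2 * γ ^ 2 * A * n * Real.exp (-E) := by
    have e1 : Real.exp (-(Real.pi * d * γ * n / 2)) ≤
        Real.exp (-(Real.pi * d * γ / 4 * n)) * Real.exp (-E) := by
      rw [← Real.exp_add]
      gcongr
      linarith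
    calc (Real.pi / h) ^ 2 * (4 * A * Real.exp (-(Real.pi * d * γ * n / 2)))
        ≤ (Real.pi * (γ * n)) ^ 2 *
          (4 * A * (Real.exp (-(Real.pi * d * γ / 4 * n)) * Real.exp (-E))) := by
          rw [div_eq_mul_inv]
          gcongr
      _ = 4 * Real.pi ^ 2 * γ ^ 2 * A *
          ((n : ℝ) ^ 2 * Real.exp (-(Real.pi * d * γ / 4 * n))) * Real.exp (-E) := by ring
      _ ≤ 4 * Real.pi ^ 2 * γ ^ 2 * A * n * Real.exp (-E) := by
          gcongr
          exact hs.trans hn'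
  have t3 : 0 ≤ n * Real.exp (-E) := by positivity
  nlinarith

/-! ### A lower bound for the weighted norm of the samples, and auxiliary inequalities. -/

lemma DoubleExpDecay.tendsto_zero {v : ℝ → ℝ} {A βL βR γL γR : ℝ}
    (hv : DoubleExpDecay v A βL βR γL γR) (hβL : 0 < βL) (hβR : 0 < βR)
    (hγL : 0 < γL) (hγR : 0 < γR) : Tendsto v (cocompact ℝ) (𝓝 0) := by
  have hlim : ∀ {β γ : ℝ}, 0 < β → 0 < γ →
      Tendsto (fun t : ℝ => A * Real.exp (-β * Real.exp (γ * t))) atTop (𝓝 0) := by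
    intro β γ hβ hγ
    have h1 : Tendsto (fun t : ℝ => -β * Real.exp (γ * t)) atTop atBot :=
      (Real.tendsto_exp_atTop.comp (tendsto_id.const_mul_atTop hγ)).const_mul_atTop_of_neg
        (by linarith)
    simpa using (Real.tendsto_exp_atBot.comp h1).const_mul A
  rw [cocompact_eq_atBot_atTop]
  refine Tendsto.sup ?_ ?_
  · refine squeeze_zero_norm' ?_ ((hlim hβL hγL).comp tendsto_abs_atBot_atTop)
    filter_upwards [eventually_le_atBot 0] with x hx using hv.1 x hx
  · refine squeeze_zero_norm' ?_ ((hlim hβR hγR).comp tendsto_abs_atTop_atTop)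
    filter_upwards [eventually_ge_atTop 0] with x hx using hv.2 x hx

/-- Since v vanishes at infinity, v² attains a positive maximum. If v''v ≥ rv² held there, then
(v²)'' = 2v'² + 2vv'' would be positive at a maximum. -/
lemma exists_pos_energy_density {v : ℝ → ℝ} {r : ℝ} (hr : 0 < r) (hne : ∃ x, v x ≠ 0)
    (hv1 : Differentiable ℝ v) (hv2 : Differentiable ℝ (deriv v))
    (hv0 : Tendsto v (cocompact ℝ) (𝓝 0)) :
    ∃ x, 0 < -deriv (deriv v) x * v x + r * v x ^ 2 := by
  obtain ⟨x₁, hx₁⟩ := hne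
  have hpos : 0 < v x₁ ^ 2 := by positivity
  have hlim : Tendsto (fun x => v x ^ 2) (cocompact ℝ) (𝓝 0) := by simpa using hv0.pow 2
  obtain ⟨x₀, hx₀⟩ := (hv1.continuous.pow 2).exists_forall_ge' x₁
    ((hlim.eventually_lt_const hpos).mono fun x hx => hx.le)
  by_contra! hcon
  have hv0pos : 0 < v x₀ ^ 2 := lt_of_lt_of_le hpos (hx₀ x₁)
  have hd1 : deriv (fun x => v x ^ 2) = fun x => 2 * v x * deriv v x := by
    ext x
    have := ((hv1 x).hasDerivAt.fun_pow 2).deriv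
    simpa [mul_assoc] using this
  have hd2 : deriv (deriv fun x => v x ^ 2) x₀ =
      2 * deriv v x₀ * deriv v x₀ + 2 * v x₀ * deriv (deriv v) x₀ := by
    rw [hd1]
    exact (((hv1 x₀).hasDerivAt.const_mul 2).mul (hv2 x₀).hasDerivAt).deriv
  have hmax : IsLocalMax (fun x => v x ^ 2) x₀ := Eventually.of_forall hx₀
  have hd2pos : 0 < deriv (deriv fun x => v x ^ 2) x₀ := by
    rw [hd2]
    have := hcon x₀
    nlinarith [mul_self_nonneg (deriv v x₀), mul_pos hr hv0pos]
  -- A local minimum that is also a local maximum makes v² locally constant, contradicting the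
  -- positive second derivative.
  have hmin := isLocalMin_of_deriv_deriv_pos hd2pos hmax.deriv_eq_zero
    (hv1.continuous.pow 2).continuousAt
  have heq : (fun x => v x ^ 2) =ᶠ[𝓝 x₀] fun _ => v x₀ ^ 2 := by
    filter_upwards [hmin, hmax] with x h1 h2 using le_antisymm h2 h1
  rw [heq.deriv.deriv_eq] at hd2pos
  simp at hd2pos

lemma IsChangeOfVariable.mem_interval {a b : EReal} {φ : ℝ → ℝ} (hφ : IsChangeOfVariable a b φ)
    (x : ℝ) : a < (φ x : EReal) ∧ (φ x : EReal) < b := by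
  have hmono : StrictMono fun x : ℝ => (φ x : EReal) :=
    EReal.coe_strictMono.comp (strictMono_of_deriv_pos hφ.deriv_pos)
  exact ⟨(hmono.monotone.le_of_tendsto hφ.tendsto_atBot (x - 1)).trans_lt (hmono (by linarith)),
    (hmono (show x < x + 1 by linarith)).trans_le
      (hmono.monotone.ge_of_tendsto hφ.tendsto_atTop (x + 1))⟩

/-- Smallness gives (μ-λ)² ≤ μλ, which rules out μ > 4λ; the unknown μ on the right can then be
replaced by 4λ. -/
lemma abs_sub_le_of_sq_sub_le {μ lam δ η : ℝ} (hlam : 0 < lam) (hδ : 0 < δ) (hη : 0 ≤ η)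
    (hμ : 0 ≤ μ) (h : (μ - lam) ^ 2 ≤ δ * μ * η ^ 2) (hsmall : δ * η ^ 2 ≤ lam) :
    |μ - lam| ≤ 2 * √(δ * lam) * η := by
  have h4 : μ ≤ 4 * lam := by
    by_contra! h4
    nlinarith [mul_le_mul_of_nonneg_left hsmall hμ]
  refine abs_le_of_sq_le_sq ?_ (by positivity)
  rw [mul_pow, mul_pow, Real.sq_sqrt (by positivity)]
  nlinarith [mul_le_mul_of_nonneg_left h4 (show 0 ≤ δ * η ^ 2 by positivity)]

lemma exists_node {x₀ h : ℝ} {M N : ℕ} (hh : 0 < h) (hM : -x₀ ≤ M * h)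
    (hN : x₀ < (N + 1) * h) :
    ∃ k ∈ Finset.Icc (-(M : ℤ)) N, |(k : ℝ) * h - x₀| ≤ h := by
  have h1 := Int.floor_le (x₀ / h)
  have h2 := Int.lt_floor_add_one (x₀ / h)
  rw [le_div_iff₀ hh] at h1
  rw [div_lt_iff₀ hh] at h2
  refine ⟨⌊x₀ / h⌋, ?_, abs_le.mpr ⟨by linarith, by linarith⟩⟩
  rw [Finset.mem_Icc]
  have h3 : ((⌊x₀ / h⌋ : ℤ) : ℝ) < N + 1 := lt_of_mul_lt_mul_right (h1.trans_lt hN) hh.le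
  have h4 : (-(M : ℝ)) < (⌊x₀ / h⌋ : ℤ) + 1 := by
    refine lt_of_mul_lt_mul_right (lt_of_le_of_lt ?_ h2) hh.le
    linarith
  have h3' : ⌊x₀ / h⌋ < (N : ℤ) + 1 := by exact_mod_cast h3
  have h4' : -(M : ℤ) < ⌊x₀ / h⌋ + 1 := by exact_mod_cast h4
  omega

/-! ### Assembly of the eigenvalue estimate. -/

lemma IsEigenpair.mulVec_sub {φ q ρ v : ℝ → ℝ} {lam h : ℝ} (hev : IsEigenpair φ q ρ lam v)
    (hh : h ≠ 0) {M N : ℕ} (j : Idx M N) :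
    (matA φ q h M N).mulVec (fun k => v ((k : ℤ) * h)) j -
        lam * (weight φ ρ ((j : ℤ) * h) * v ((j : ℤ) * h)) =
      deriv (deriv v) ((j : ℤ) * h) + (Real.pi / h) ^ 2 *
        ∑ k ∈ Finset.Icc (-(M : ℤ)) N, sincMoment (k - j) * v (k * h) := by
  have h1 := hev.equation ((j : ℤ) * h)
  have h2 : (matA φ q h M N).mulVec (fun k => v ((k : ℤ) * h)) j =
      (Real.pi / h) ^ 2 * ∑ k ∈ Finset.Icc (-(M : ℤ)) N, sincMoment (k - j) * v (k * h) +
        qTilde φ q ((j : ℤ) * h) * v ((j : ℤ) * h) := by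
    simp only [Matrix.mulVec, dotProduct, matA_apply hh, add_mul, Finset.sum_add_distrib,
      ite_mul, zero_mul, Finset.sum_ite_eq, Finset.mem_univ, if_true]
    rw [← Finset.sum_coe_sort (Finset.Icc (-(M : ℤ)) N), Finset.mul_sum, div_pow]
    congr 1
    exact Finset.sum_congr rfl fun k _ => by ring
  rw [h2]
  linarith

theorem eventually_exists_genEigenvalue_near {v φ q ρ : ℝ → ℝ} {d : ℝ} (hd : 0 < d)
    {lam δ A βL βR γL γR : ℝ} (hw : ∀ x, 0 < weight φ ρ x) (hev : IsEigenpair φ q ρ lam v)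
    (hA : 0 < A) (hβL : 0 < βL) (hβR : 0 < βR) (hγL : 0 < γL) (hγR : 0 < γR)
    (hdec : DoubleExpDecay v A βL βR γL γR) (hB : RealMemB2 d v) (hδ : 0 < δ)
    (hq : ∀ x, δ⁻¹ ≤ qTilde φ q x) :
    ∃ C : ℝ, ∀ᶠ n : ℕ in atTop,
      let γ := max γL γR
      let β := meshBeta βL βR γL γR
      let h := meshSize d γ β n
      let M := leftPoints d βL βR γL γR n
      let N := rightPoints d βL βR γL γR n
      0 < h ∧ ∃ μ : ℝ, IsGenEigenvalue (matA φ q h M N) (matD2 φ ρ h M N) μ ∧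
        |μ - lam| ≤ C * √(δ * lam) * ((n : ℝ) ^ 2 *
          Real.exp (-(Real.pi * d * γ * n / Real.log (Real.pi * d * γ * n / β)))) := by
  obtain ⟨hcont, C₀, hC₀, herr⟩ :=
    hB.exists_sinc_error hd hev.differentiable hev.differentiable_deriv
  obtain ⟨x₀, hx₀⟩ := exists_pos_energy_density (inv_pos.mpr hδ) hev.nontrivial hev.differentiable
    hev.differentiable_deriv (hdec.tendsto_zero hβL hβR hγL hγR)
  set ψ : ℝ → ℝ := fun x => -deriv (deriv v) x * v x + δ⁻¹ * v x ^ 2 with hψ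
  -- The equation multiplied by v, with q̃ ≥ 1/δ. Positivity of ψ at x₀ also forces λ > 0.
  have hψle : ∀ x, ψ x ≤ lam * (weight φ ρ x * v x ^ 2) := by
    intro x
    have h1 := hev.equation x
    have h2 : lam * (weight φ ρ x * v x ^ 2) =
        -deriv (deriv v) x * v x + qTilde φ q x * v x ^ 2 := by linear_combination (-(v x)) * h1
    rw [h2]
    have := mul_le_mul_of_nonneg_right (hq x) (sq_nonneg (v x))
    simp only [hψ]; linarith
  have hlam : 0 < lam := by
    have h1 : 0 < lam * (weight φ ρ x₀ * v x₀ ^ 2) := lt_of_lt_of_le hx₀ (hψle x₀)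
    exact pos_of_mul_pos_left h1 (mul_nonneg (hw x₀).le (sq_nonneg _))
  obtain ⟨r, hr, hball⟩ : ∃ r > 0, ∀ x, |x - x₀| < r → ψ x₀ / 2 < ψ x := by
    have hψc : Continuous ψ :=
      (hcont.neg.mul hev.differentiable.continuous).add
        (continuous_const.mul (hev.differentiable.continuous.pow 2))
    obtain ⟨r, hr, hsub⟩ := Metric.eventually_nhds_iff.mp
      ((hψc.tendsto x₀).eventually_const_lt (half_lt_self hx₀))
    exact ⟨r, hr, fun x hx => hsub (by rwa [Real.dist_eq])⟩
  set γ := max γL γR with hγdef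
  set β := meshBeta βL βR γL γR with hβdef
  have hγ : 0 < γ := lt_max_of_lt_left hγL
  have hβ : 0 < β := by
    rw [hβdef, meshBeta]; split_ifs <;> assumption
  obtain ⟨C₁, hC₁, hbound⟩ := eventually_error_bound_le hd hγ hβ hC₀ hA.le
  obtain ⟨C₂, hC₂, hpoints⟩ := eventually_points hd hβL hβR hγL hγR
  set c := ψ x₀ / 2 / lam with hc
  have hc0 : 0 < c := by positivity
  -- The node count C₂n enters once from the pigeonhole choice and once from summing squared
  -- residuals; the square root leaves one factor C₂n beside C₁nE.
  set C₃ := C₂ * C₁ / √c with hC₃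
  have hC₃0 : 0 < C₃ := by positivity
  refine ⟨2 * C₃, ?_⟩
  have hmesh := tendsto_meshSize hd hγ hβ
  have hlog := Real.tendsto_log_atTop.comp (tendsto_const_mul_natCast_div hd hγ hβ)
  have hhalf : Tendsto (fun n : ℕ => Real.pi * d * γ * n / 2) atTop atTop :=
    (tendsto_natCast_atTop_atTop.const_mul_atTop (by positivity)).atTop_div_const two_pos
  have hsides : ∀ {γ' : ℝ}, 0 < γ' → ∀ᶠ n : ℕ in atTop,
      1 ≤ Real.pi * d * γ * n / 2 * (γ' * meshSize d γ β n) := by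
    intro γ' hγ'
    have := hlog.const_mul_atTop (show 0 < Real.pi * d * γ' / 2 by positivity)
    filter_upwards [this.eventually_ge_atTop 1, eventually_gt_atTop 0] with n h1 hn
    have hn' : (0 : ℝ) < n := by exact_mod_cast hn
    refine h1.trans_eq ?_
    simp only [Function.comp_apply, meshSize]
    field_simp
  have hη : Tendsto (fun n : ℕ => δ * (C₃ * ((n : ℝ) ^ 2 * Real.exp (-(Real.pi * d * γ * n /
      Real.log (Real.pi * d * γ * n / β))))) ^ 2) atTop (𝓝 0) := by
    have h1 := tendsto_sq_mul_exp_neg_div_log (c := Real.pi * d * γ) (γ' := Real.pi * d * γ / β)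
      (by positivity) (by positivity)
    have h2 := ((h1.const_mul C₃).pow 2).const_mul δ
    simp only [mul_zero, ne_eq, OfNat.ofNat_ne_zero, not_false_eq_true, zero_pow] at h2
    refine h2.congr fun n => ?_
    rw [mul_div_right_comm _ (n : ℝ) β]
  filter_upwards [hbound, hpoints, hsides hγL, hsides hγR, hη.eventually_le_const hlam,
    hmesh.eventually_lt_const (lt_min one_pos hr), hlog.eventually_gt_atTop 0,
    hhalf.eventually_gt_atTop (βL * Real.exp (γL * (|x₀| + 1))),
    hhalf.eventually_gt_atTop (βR * Real.exp (γR * (|x₀| + 1))), eventually_gt_atTop 0]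
    with n hn1 hn2 hsL hsR hsmall hhr hl hxL hxR hn
  simp only
  obtain ⟨hpL, hpR, hcard⟩ := hn2
  have hh : 0 < meshSize d γ β n := meshSize_pos hγ hn hl
  set h := meshSize d γ β n with hhdef
  set M := leftPoints d βL βR γL γR n
  set N := rightPoints d βL βR γL γR n
  set E := Real.exp (-(Real.pi * d * γ * n / Real.log (Real.pi * d * γ * n / β))) with hE
  -- The exponents at the first omitted nodes grow without bound, so those nodes eventually lie
  -- beyond |x₀| + 1. As h < 1, the window then contains a node within h of x₀.
  have hfar : ∀ {β' γ' t : ℝ}, 0 < β' → 0 < γ' →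
      β' * Real.exp (γ' * (|x₀| + 1)) < β' * Real.exp (γ' * t) → |x₀| + 1 < t := by
    intro β' γ' t hβ' hγ' hlt
    exact lt_of_mul_lt_mul_left (Real.exp_lt_exp.mp (lt_of_mul_lt_mul_left hlt hβ'.le)) hγ'.le
  have hML := hfar hβL hγL (hxL.trans_le hpL)
  have hNR := hfar hβR hγR (hxR.trans_le hpR)
  have hh1 : h < 1 := hhr.trans_le (min_le_left _ _)
  obtain ⟨k, hk, hkx⟩ := exists_node (x₀ := x₀) hh (M := M) (N := N)
    (by linarith [neg_abs_le x₀]) (by linarith [le_abs_self x₀])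
  have hkψ := hball _ (hkx.trans_lt (hhr.trans_le (min_le_right _ _)))
  set z : Idx M N → ℝ := fun i => v ((i : ℤ) * h) with hz
  set w : Idx M N → ℝ := fun i => weight φ ρ ((i : ℤ) * h) with hwdef
  have hcz : c ≤ ∑ i, w i * z i ^ 2 := by
    have h1 : w ⟨k, hk⟩ * z ⟨k, hk⟩ ^ 2 ≤ ∑ i, w i * z i ^ 2 :=
      Finset.single_le_sum (f := fun i => w i * z i ^ 2)
        (fun i _ => mul_nonneg (hw _).le (sq_nonneg _)) (Finset.mem_univ _)
    refine le_trans ?_ h1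
    rw [hc, div_le_iff₀' hlam]
    exact hkψ.le.trans (hψle _)
  obtain ⟨μ, hμ0, hμ, hle⟩ := exists_genEigenvalue_near (matA_isHermitian (φ := φ) (q := q) hh.ne' M N)
    (w := w) (fun i => hw _) hδ (le_matA_quadratic hh.ne' hq) z lam hc0 hcz
  refine ⟨hh, μ, by rwa [matD2_eq hh.ne'], ?_⟩
  have hres : ∀ j : Idx M N,
      |(matA φ q h M N).mulVec z j - lam * (w j * z j)| ≤ C₁ * n * E := by
    intro j
    obtain ⟨e, he, hev'⟩ := herr h hh j
    rw [hev.mulVec_sub hh.ne' j]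
    refine (abs_collocation_error_le he hev' fun s hs => ?_).trans hn1
    exact hdec.sum_outside_le hA.le hγL hγR hh hpL hpR hsL hsR hs
  have hE0 : 0 < E := Real.exp_pos _
  have hn' : (0 : ℝ) < n := by exact_mod_cast hn
  have hcardeq : (Fintype.card (Idx M N) : ℝ) = M + N + 1 := by
    rw [Fintype.card_coe, Int.card_Icc, show ((N : ℤ) + 1 - -(M : ℤ)).toNat = M + N + 1 by omega]
    push_cast; ring
  have hsum : ∑ i, ((matA φ q h M N).mulVec z i - lam * (w i * z i)) ^ 2 ≤
      C₂ * n * (C₁ * n * E) ^ 2 := by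
    calc ∑ i, ((matA φ q h M N).mulVec z i - lam * (w i * z i)) ^ 2
        ≤ ∑ _i : Idx M N, (C₁ * n * E) ^ 2 := Finset.sum_le_sum fun i _ =>
          sq_le_sq' (abs_le.mp (hres i)).1 (abs_le.mp (hres i)).2
      _ = Fintype.card (Idx M N) * (C₁ * n * E) ^ 2 := by
          rw [Finset.sum_const, Finset.card_univ, nsmul_eq_mul]
      _ ≤ _ := by rw [hcardeq]; gcongr
  have hsq : (μ - lam) ^ 2 ≤ δ * μ * (C₃ * ((n : ℝ) ^ 2 * E)) ^ 2 := by
    have h1 : c * (μ - lam) ^ 2 ≤ C₂ * n * (δ * μ * (C₂ * n * (C₁ * n * E) ^ 2)) := by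
      refine hle.trans ?_
      rw [hcardeq]
      gcongr
    have h2 : C₃ ^ 2 * c = (C₂ * C₁) ^ 2 := by
      rw [hC₃, div_pow, Real.sq_sqrt hc0.le]; field_simp
    refine le_of_mul_le_mul_left (h1.trans_eq ?_) hc0
    linear_combination (-(δ * μ * (n : ℝ) ^ 4 * E ^ 2)) * h2
  have := abs_sub_le_of_sq_sub_le hlam hδ (by positivity) hμ0 hsq hsmall
  linarith

end DESCM

end


theorem theorem1 (v : ℝ → ℝ) (d : ℝ) (hd : 0 < d) :
    ∃ K : ℝ, 0 < K ∧
      ∀ (a b : EReal) (q ρ φ : ℝ → ℝ) (lam δ A βL βR γL γR : ℝ),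
        a < b →
        (∀ x : ℝ, a < (x : EReal) → (x : EReal) < b → 0 ≤ q x ∧ 0 < ρ x) →
        DESCM.IsChangeOfVariable a b φ →
        DESCM.IsEigenpair φ q ρ lam v →
        0 < A → 0 < βL → 0 < βR → 0 < γL → 0 < γR →
        DESCM.DoubleExpDecay v A βL βR γL γR →
        DESCM.RealMemB2 d v →
        d ≤ Real.pi / (2 * max γL γR) →
        0 < δ →
        (∀ x, δ⁻¹ ≤ DESCM.qTilde φ q x) →
        ∀ᶠ n : ℕ in Filter.atTop,
          let γ := max γL γR
          let β := DESCM.meshBeta βL βR γL γR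
          let h := DESCM.meshSize d γ β n
          let M := DESCM.leftPoints d βL βR γL γR n
          let N := DESCM.rightPoints d βL βR γL γR n
          (DESCM.matA φ q h M N).PosDef ∧
          (DESCM.matD2 φ ρ h M N).PosDef ∧
          ∃ μ : ℝ, DESCM.IsGenEigenvalue (DESCM.matA φ q h M N) (DESCM.matD2 φ ρ h M N) μ ∧
            |μ - lam| ≤ K * √(δ * lam) * ((n : ℝ) ^ (5 / 2 : ℝ) / Real.log n ^ 2) *
              Real.exp (-(Real.pi * d * γ * n / Real.log (Real.pi * d * γ * n / β))) := by
  -- K = 1 suffices: eventually C log²n ≤ √n, whatever the constant C of the problem.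
  refine ⟨1, one_pos, fun a b q ρ φ lam δ A βL βR γL γR _ hqρ hφ hev hA hβL hβR hγL hγR hdec hB _
    hδ hq => ?_⟩
  have hw : ∀ x, 0 < DESCM.weight φ ρ x := fun x =>
    mul_pos (hqρ _ (hφ.mem_interval x).1 (hφ.mem_interval x).2).2 (pow_pos (hφ.deriv_pos x) 2)
  obtain ⟨C, hC⟩ := DESCM.eventually_exists_genEigenvalue_near hd hw hev hA hβL hβR hγL hγR hdec hB
    hδ hq
  filter_upwards [hC, DESCM.eventually_mul_log_sq_le_sqrt C, Filter.eventually_ge_atTop 2]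
    with n hn hlog hn2
  obtain ⟨hh, μ, hμ, hle⟩ := hn
  refine ⟨DESCM.matA_posDef hh.ne' (inv_pos.mpr hδ) _ _ hq, DESCM.matD2_posDef hh.ne' _ _ hw, μ, hμ,
    hle.trans ?_⟩
  have hn1 : (1 : ℝ) < n := by exact_mod_cast hn2
  have hn0 : (0 : ℝ) < n := by linarith
  have hl : 0 < Real.log n := Real.log_pos hn1
  have hpow : C * (n : ℝ) ^ 2 ≤ (n : ℝ) ^ (5 / 2 : ℝ) / Real.log n ^ 2 := by
    rw [le_div_iff₀ (by positivity), show (5 / 2 : ℝ) = (2 : ℕ) + 1 / 2 by norm_num,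
      Real.rpow_add hn0, Real.rpow_natCast, ← Real.sqrt_eq_rpow]
    nlinarith [mul_le_mul_of_nonneg_left hlog (sq_nonneg (n : ℝ))]
  set E := Real.exp (-(Real.pi * d * max γL γR * n /
    Real.log (Real.pi * d * max γL γR * n / DESCM.meshBeta βL βR γL γR)))
  calc C * √(δ * lam) * ((n : ℝ) ^ 2 * E) = √(δ * lam) * (C * (n : ℝ) ^ 2) * E := by ring
    _ ≤ √(δ * lam) * ((n : ℝ) ^ (5 / 2 : ℝ) / Real.log n ^ 2) * E := by gcongr
    _ = _ := by ring
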